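/- **Setting.** Let $M=(N,\mathcal I)$ be a matroid on a finite ground set $N$ with rank function $r$ and span (closure) $\operatorname{span}_M(S)=\{e\in N: r(S\cup\{e\})=r(S)\}$, and assume that $M$ has no loops (every singleton $\{e\}$, $e\in N$, is independent). Let $P_M\subseteq[0,1]^N$ be the matroid polytope, i.e. the convex hull of the incidence vectors of the independent sets. For $x\in[0,1]^N$ let $R(x)\subseteq N$ be the random set containing each $e\in N$ independently with probability $x_e$, and let $\mathcal D(x)$ be its distribution. For $C\subseteq N$, $M|_C$ and $x|_C$ denote restrictions to $C$. A *spanning chain* of $N$ is a tuple $\mathcal C=(C_0,\dots,C_k)$ with $N=C_0\supseteq C_1\supseteq\dots\supseteq C_k=\emptyset$. For $e\in N$, with $i$ the unique index such that $e\in C_i\setminus C_{i+1}$, the *$\mathcal C$-freeness* of $e$ with respect to $M$ and $x$ is $$\Pr\big[e\notin\operatorname{span}_M\big(((R(x)\setminus\{e\})\cap C_i)\cup C_{i+1}\big)\big].$$ A probability distribution over spanning chains of $N$ is *$c$-balanced for $x$* if for every $e\in N$ the expected $\mathcal C$-freeness of $e$, over $\mathcal C$ drawn from the distribution, is at least $c$.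 **Procedure SingleOcrsLink$(M,x,\rho,\tau,\varepsilon)$.** Let $\eta=\left\lceil 1+\log_{1+\varepsilon}\frac{\ln\rho}{\varepsilon^3}\right\rceil$ and $q=\left\lceil\frac{6}{\tau\varepsilon^2}\ln\frac{\ln\rho}{\varepsilon}\right\rceil$. Choose a random $\overline h\in\{1,\dots,\eta\}$ with $\Pr[\overline h=1]=(1+\varepsilon)^{-(\eta-1)}$ and $\Pr[\overline h=h]=\varepsilon\cdot\Pr[\overline h<h]$ for $2\le h\le\eta$. Set $A_0=\emptyset$. For $h=1,\dots,\overline h$, draw $q$ fresh independent samples $S_1,\dots,S_q$ from $\mathcal D(x)$ and let $A_h$ be the set of all $e$ in the ground set of $M$ with $\frac1q\,|\{p\in\{1,\dots,q\}: e\in\operatorname{span}_M(A_{h-1}\cup S_p)\}|>\tau$. Return $A_{\overline h}$. **Procedure OcrsChain$(M,x,\tau,\varepsilon)$.** Let $\rho=\max\{r(N),3\}$, $\zeta=\left\lceil\frac1\varepsilon\ln\frac\rho\varepsilon\right\rceil$, $C_0=N$ and $C_{\zeta+1}=\emptyset$. For $i=1,\dots,\zeta$ let $C_i$ be the output of SingleOcrsLink$(M|_{C_{i-1}},x|_{C_{i-1}},\rho,(1-\varepsilon)\tau,\varepsilon)$,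 using fresh randomness. Return $(C_0,C_1,\dots,C_{\zeta+1})$. **Theorem.** Let $M$ be a loopless matroid as above, $\varepsilon\in(0,\tfrac1{20}]$, $\lambda\in(0,1-4\varepsilon]$ and $x\in\lambda\cdot P_M$. Then the random output of OcrsChain$(M,x,\lambda+4\varepsilon,\varepsilon)$ is always a spanning chain of $N$, and its distribution is $(1-\lambda-8\varepsilon)$-balanced for $x$: for every $e\in N$ its expected $\mathcal C$-freeness with respect to $M$ and $x$ is at least $1-\lambda-8\varepsilon$. -/

import Mathlib

open scoped ENNReal NNReal Pointwise

noncomputable section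

namespace MatroidOCRS

/-- The matroid polytope: the convex hull of the incidence vectors of the independent sets. -/
def matroidPolytope {α : Type*} (M : Matroid α) : Set (α → ℝ) :=
  convexHull ℝ {v | ∃ I : Set α, M.Indep I ∧ v = I.indicator 1}

open Classical in
/-- Probability that the random active set `R(x)` equals `S`, if every element `e` belongs to
`R(x)` independently with probability `x e`. -/
def activeWeight {α : Type*} [Fintype α] (x : α → unitInterval) (S : Set α) : ℝ≥0∞ :=
  ∏ e, if e ∈ S then ENNReal.ofReal (x e) else ENNReal.ofReal (1 - x e)

theorem sum_activeWeight {α : Type*} [Fintype α] (x : α → unitInterval) :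
    ∑ S, activeWeight x S = 1 := by
  classical
  have h1 : ∏ e : α, (ENNReal.ofReal (x e) + ENNReal.ofReal (1 - x e)) = 1 := by
    refine Finset.prod_eq_one fun e _ => ?_
    rw [← ENNReal.ofReal_add (x e).2.1 (sub_nonneg.2 (x e).2.2)]
    simp
  rw [← h1, Fintype.prod_add]
  symm
  refine Fintype.sum_equiv Fintype.finsetEquivSet _ _ fun t => ?_
  simp only [activeWeight, Fintype.finsetEquivSet_apply, Finset.mem_coe]
  rw [Finset.prod_ite]
  congr 1
  · congr 1; ext e; simp
  · congr 1; ext e; simp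

/-- The product distribution `D(x)` of the random set `R(x)`. -/
def activeDist {α : Type*} [Fintype α] (x : α → unitInterval) : PMF (Set α) :=
  PMF.ofFintype (activeWeight x) (sum_activeWeight x)

/-- The restriction of the vector `x` to the coordinates in `C`, extended by zero, so that
`activeDist (restrictVec x C)` is the distribution `D(x|_C)` on subsets of `C`. -/
def restrictVec {α : Type*} (x : α → unitInterval) (C : Set α) : α → unitInterval :=
  C.indicator x

/-- The distribution of `n` independent samples from `p`. -/
def iidSamples {β : Type*} (p : PMF β) : ℕ → PMF (List β)
  | 0 => PMF.pure []
  | n + 1 => p.bind fun a => (iidSamples p n).map fun l => a :: l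

/-- A tuple `(C_0, …, C_k)` of sets is a spanning chain of `N` if
`N = C_0 ⊇ C_1 ⊇ ⋯ ⊇ C_k = ∅`. -/
def IsSpanningChain {α : Type*} (N : Set α) (chain : List (Set α)) : Prop :=
  chain.head? = some N ∧ chain.getLast? = some ∅ ∧ chain.IsChain (fun A B => B ⊆ A)

open Classical in
/-- The freeness of `e` with respect to a chain, the matroid `M` and the vector `x`: the
probability that `e ∉ span (((R(x) \ {e}) ∩ C_i) ∪ C_{i+1})`, where `i` is the index with
`e ∈ C_i \ C_{i+1}` (unique for a spanning chain of a set that contains `e`). -/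
def freeness {α : Type*} [Fintype α] (M : Matroid α) (x : α → unitInterval) (e : α) :
    List (Set α) → ℝ≥0∞
  | C :: C' :: rest =>
      if e ∈ C \ C' then
        (activeDist x).toOuterMeasure {R | e ∉ M.closure (((R \ {e}) ∩ C) ∪ C')}
      else freeness M x e (C' :: rest)
  | _ => 0

/-- The expected freeness of `e` over a random chain with distribution `𝒮`. -/
def expectedFreeness {α : Type*} [Fintype α] (M : Matroid α) (x : α → unitInterval)
    (𝒮 : PMF (List (Set α))) (e : α) : ℝ :=
  (∑' chain, 𝒮 chain * freeness M x e chain).toReal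

/-- `𝒮` is a distribution over spanning chains of the ground set of `M`, and it is `c`-balanced
for `x`. -/
def IsBalancedSpanningChainDist {α : Type*} [Fintype α] (M : Matroid α) (x : α → unitInterval)
    (c : ℝ) (𝒮 : PMF (List (Set α))) : Prop :=
  (∀ chain ∈ 𝒮.support, IsSpanningChain M.E chain) ∧
    ∀ e ∈ M.E, c ≤ expectedFreeness M x 𝒮 e

/-- The probabilities `Pr[h̄ = h]`:
`Pr[h̄ = 1] = 1 / (1 + ε) ^ (η - 1)` and `Pr[h̄ = h] = ε * Pr[h̄ < h]` for `h ≥ 2`. -/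
def stopWeight (ε : ℝ≥0) (η : ℕ) : ℕ → ℝ≥0
  | 0 => 0
  | 1 => 1 / (1 + ε) ^ (η - 1)
  | h + 2 => ε * ∑ j : Fin (h + 2), stopWeight ε η j

theorem sum_stopWeight (ε : ℝ≥0) (η h : ℕ) :
    ∑ j ∈ Finset.range (h + 2), stopWeight ε η j = (1 + ε) ^ h * (1 / (1 + ε) ^ (η - 1)) := by
  induction h with
  | zero => simp [Finset.sum_range_succ, stopWeight]
  | succ h ih =>
    rw [Finset.sum_range_succ, stopWeight, Fin.sum_univ_eq_sum_range (stopWeight ε η) (h + 2), ih]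
    ring

/-- The distribution of the random number `h̄ ∈ {1, …, η}` of iterations. -/
def stopDist (ε : ℝ≥0) (η : ℕ) (hη : 1 ≤ η) : PMF ℕ :=
  PMF.ofFinset (fun h => if h ∈ Finset.Icc 1 η then (stopWeight ε η h : ℝ≥0∞) else 0)
    (Finset.Icc 1 η)
    (by
      rw [Finset.sum_congr rfl fun h hh => if_pos hh]
      obtain ⟨m, rfl⟩ := Nat.exists_eq_add_of_le' hη
      have h0 := sum_stopWeight ε (m + 1) m
      rw [Finset.sum_range_succ', stopWeight, add_zero, Nat.add_sub_cancel,
        mul_one_div_cancel (by positivity)] at h0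
      have h1 : ∑ a ∈ Finset.Icc 1 (m + 1), stopWeight ε (m + 1) a = 1 := by
        rw [← h0, Finset.range_eq_Ico,
          Finset.sum_Ico_add' (fun k => stopWeight ε (m + 1) k) 0 (m + 1) 1]
        rfl
      exact_mod_cast h1)
    (fun _ hh => if_neg hh)

open Classical in
/-- One iteration: from `A = A_{h-1}`, draw `q` fresh independent samples from `D(x)`, and return
the set `A_h` of the elements `e` for which the fraction of the samples `S` with
`e ∈ span (A ∪ S)` exceeds `τ`. -/
def linkStep {α : Type*} [Fintype α] (M : Matroid α) (x : α → unitInterval) (τ : ℝ) (q : ℕ)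
    (A : Set α) : PMF (Set α) :=
  (iidSamples (activeDist x) q).map fun samples =>
    {e ∈ M.E | τ < (samples.countP fun S => decide (e ∈ M.closure (A ∪ S)) : ℕ) / (q : ℝ)}

/-- The distribution of the set `A_h`, starting from `A_0 = ∅`. -/
def linkIter {α : Type*} [Fintype α] (M : Matroid α) (x : α → unitInterval) (τ : ℝ) (q : ℕ) :
    ℕ → PMF (Set α)
  | 0 => PMF.pure ∅
  | h + 1 => (linkIter M x τ q h).bind (linkStep M x τ q)

/-- The maximal number `η = ⌈1 + log_{1+ε} (ln ρ / ε³)⌉` of iterations. (The maximum with `1` only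
serves to make the definition total; it has no effect when `ln ρ ≥ ε³` and `0 < ε`.) -/
def maxIter (ρ : ℕ) (ε : ℝ) : ℕ :=
  max 1 ⌈1 + Real.logb (1 + ε) (Real.log ρ / ε ^ 3)⌉₊

/-- The number `q = ⌈6 / (τ ε²) * ln (ln ρ / ε)⌉` of samples per iteration. -/
def numSamples (ρ : ℕ) (τ ε : ℝ) : ℕ :=
  ⌈6 / (τ * ε ^ 2) * Real.log (Real.log ρ / ε)⌉₊

/-- The distribution of the output of the procedure `SingleOcrsLink(M, x, ρ, τ, ε)`. -/
def singleOcrsLink {α : Type*} [Fintype α] (M : Matroid α) (x : α → unitInterval) (ρ : ℕ)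
    (τ ε : ℝ) : PMF (Set α) :=
  (stopDist ε.toNNReal (maxIter ρ ε) (le_max_left _ _)).bind fun h =>
    linkIter M x τ (numSamples ρ τ ε) h

/-- The distribution of the remaining chain `(C, …, ∅)`, when the current link is `C` and `n`
further links have to be constructed before the final link `∅`. -/
def ocrsLinks {α : Type*} [Fintype α] (M : Matroid α) (x : α → unitInterval) (ρ : ℕ)
    (τ ε : ℝ) : ℕ → Set α → PMF (List (Set α))
  | 0, C => PMF.pure [C, ∅]
  | n + 1, C =>
      (singleOcrsLink (M.restrict C) (restrictVec x C) ρ ((1 - ε) * τ) ε).bind fun C' =>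
        (ocrsLinks M x ρ τ ε n C').map fun rest => C :: rest

/-- The distribution of the output `(C_0, …, C_{ζ+1})` of the procedure
`OcrsChain(M, x, τ, ε)`, where `ρ = max {rank M, 3}` and `ζ = ⌈(1 / ε) * ln (ρ / ε)⌉`. -/
def ocrsChain {α : Type*} [Fintype α] (M : Matroid α) (x : α → unitInterval) (τ ε : ℝ) :
    PMF (List (Set α)) :=
  let ρ : ℕ := max M.eRank.toNat 3
  let ζ : ℕ := ⌈1 / ε * Real.log (ρ / ε)⌉₊
  ocrsLinks M x ρ τ ε ζ M.E

end MatroidOCRS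

end

/-!
The argument has two parts: elements that leave the chain are rarely spanned, and almost no element
survives until the last link before `∅`.

*Freeness.* Let `e` lie in a link `C`, let `A_1, A_2, …` be the iterates inside `C`, and call `A`
bad for `e` if `e ∉ A` is spanned by `A` and the active elements of `C` with probability more than
`τ = l + 4 * ε`. Elements enter an iterate at the lower threshold `τ' = (1 - ε) * τ`; so if `A_h` is
bad, then `e` enters `A_{h+1}` with probability close to `1`, by a Chernoff bound
(`expect_countP_le`). Hence the probability that `A_h` is bad is at most `u_h - u_{h+1}` plus a tiny
error, where `u_h` is the probability of `e ∉ A_h`. The weights of the random number of iterations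
grow by factors of at most `1 + ε`, so that summation by parts (`expect_stopDist_decrement_le`)
bounds the average of `u_h - u_{h+1}` by `ε` times the average of `u_h`, up to the first weight. So
`e` is spanned with conditional probability at most `τ + ε` when it leaves the chain, up to an error
that sums to at most `2 * ε` over all links.

*Rank.* The expected rank of a link is at most `1 - ε` times the rank of the previous one
(`expect_rk_singleOcrsLink_le`), so the last link before `∅` has expected rank at most `ε`, which
bounds the probability that a given nonloop is still in it. If every element added to `A` were
spanned by `A` and a fresh sample `S` with probability at least `b`, then the potential
`E[rk (S ∪ A)] - (1 - b) * rk A` would not increase; it starts at most at `l * rk C`, and it is at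
least `b * rk A`. An element is added, however, because the samples *at hand* span it, and since the
number of elements is not bounded in terms of the number of samples, some added elements may be
spanned by fresh samples only with small probability. This overfitting is controlled by
exchangeability: among `q + 1` samples, no sample is special, and the selection by `q + 1` samples
lies between selections by `q` samples for two consecutive thresholds `j` and `j - 1` on the count
(`expect_rk_union_spannedOften_le`). The expected rank of the selection is bounded, so it cannot
grow geometrically while the threshold is lowered from `τ' * q` to about `(τ' - ε) * q`; at some `j`
in this range, the two selections have almost the same expected rank, and for this `j` the potential
hardly increases (`exists_threshold`). Lowering the threshold only enlarges the selection, and the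
iteration is monotone, so this suffices for an upper bound on the rank (`stepValue_iterate_rk_le`).

All expectations are taken in `ℝ≥0∞`, and inequalities between them are kept additive, so that no
summability has to be checked.
-/

open scoped ENNReal NNReal Pointwise

noncomputable section

namespace MatroidOCRS

/-! ### Expectations under discrete distributions -/

/-- The expectation of an extended nonnegative function under a discrete distribution. -/
def expect {β : Type*} (p : PMF β) (f : β → ℝ≥0∞) : ℝ≥0∞ := ∑' b, p b * f b

section Expectation

variable {β γ : Type*}

theorem expect_pure (a : β) (f : β → ℝ≥0∞) : expect (PMF.pure a) f = f a := by
  rw [expect, tsum_eq_single a]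
  · simp
  · intro b hb
    simp [PMF.pure_apply, hb]

theorem expect_bind (p : PMF β) (k : β → PMF γ) (f : γ → ℝ≥0∞) :
    expect (p.bind k) f = expect p fun a => expect (k a) f := by
  simp only [expect, PMF.bind_apply, ← ENNReal.tsum_mul_right, ← ENNReal.tsum_mul_left]
  rw [ENNReal.tsum_comm]
  simp only [mul_assoc]

theorem expect_map (p : PMF β) (k : β → γ) (f : γ → ℝ≥0∞) :
    expect (p.map k) f = expect p fun a => f (k a) := by
  rw [PMF.map, expect_bind]
  simp [expect_pure]

theorem expect_mono_of_mem_support {p : PMF β} {f g : β → ℝ≥0∞}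
    (h : ∀ b ∈ p.support, f b ≤ g b) : expect p f ≤ expect p g := by
  refine ENNReal.tsum_le_tsum fun b => ?_
  by_cases hb : b ∈ p.support
  · gcongr
    exact h b hb
  · simp [(p.apply_eq_zero_iff b).2 hb]

theorem expect_mono (p : PMF β) {f g : β → ℝ≥0∞} (h : ∀ b, f b ≤ g b) :
    expect p f ≤ expect p g :=
  expect_mono_of_mem_support fun b _ => h b

theorem expect_add (p : PMF β) (f g : β → ℝ≥0∞) :
    expect p (fun b => f b + g b) = expect p f + expect p g := by
  simp only [expect, mul_add, ENNReal.tsum_add]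

theorem expect_const (p : PMF β) (c : ℝ≥0∞) : expect p (fun _ => c) = c := by
  simp [expect, ENNReal.tsum_mul_right]

theorem expect_const_mul (p : PMF β) (c : ℝ≥0∞) (f : β → ℝ≥0∞) :
    expect p (fun b => c * f b) = c * expect p f := by
  simp only [expect, ← ENNReal.tsum_mul_left, mul_left_comm]

theorem expect_mul_const (p : PMF β) (c : ℝ≥0∞) (f : β → ℝ≥0∞) :
    expect p (fun b => f b * c) = expect p f * c := by
  simp only [mul_comm _ c, expect_const_mul]

theorem expect_sum {ι : Type*} (p : PMF β) (s : Finset ι) (f : ι → β → ℝ≥0∞) :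
    expect p (fun b => ∑ i ∈ s, f i b) = ∑ i ∈ s, expect p (f i) := by
  classical
  induction s using Finset.induction_on with
  | empty => simpa using expect_const p 0
  | insert i s hi ih => simp only [Finset.sum_insert hi, expect_add, ih]

theorem expect_comm (p : PMF β) (p' : PMF γ) (f : β → γ → ℝ≥0∞) :
    expect p (fun a => expect p' (f a)) = expect p' fun b => expect p fun a => f a b := by
  simp only [expect, ← ENNReal.tsum_mul_left]
  rw [ENNReal.tsum_comm]
  simp only [mul_left_comm]

theorem expect_le_of_le {p : PMF β} {f : β → ℝ≥0∞} {c : ℝ≥0∞} (h : ∀ b ∈ p.support, f b ≤ c) :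
    expect p f ≤ c :=
  (expect_mono_of_mem_support h).trans_eq (expect_const p c)

theorem toOuterMeasure_eq_expect (p : PMF β) (P : β → Prop) [DecidablePred P] :
    p.toOuterMeasure {b | P b} = expect p fun b => if P b then 1 else 0 := by
  rw [PMF.toOuterMeasure_apply, expect]
  refine tsum_congr fun b => ?_
  by_cases h : P b <;> simp [h]

/-! ### Independent samples -/

theorem expect_iidSamples_succ (p : PMF β) (n : ℕ) (F : List β → ℝ≥0∞) :
    expect (iidSamples p (n + 1)) F =
      expect p fun a => expect (iidSamples p n) fun l => F (a :: l) := by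
  simp only [iidSamples, expect_bind, expect_map]

theorem length_of_mem_support_iidSamples (p : PMF β) (n : ℕ) (l : List β)
    (hl : l ∈ (iidSamples p n).support) : l.length = n := by
  induction n generalizing l with
  | zero => simp_all [iidSamples]
  | succ n ih =>
    simp only [iidSamples, PMF.mem_support_bind_iff, PMF.mem_support_map_iff] at hl
    obtain ⟨a, -, l', hl', rfl⟩ := hl
    simp [ih l' hl']

/-- Exchangeability of independent samples: every one of the `n + 1` samples plays the same role
as the first one, when the other data depend only on the multiset of the samples. -/
theorem expect_iidSamples_sum (p : PMF β) (n : ℕ) (ψ : β → Multiset β → ℝ≥0∞) :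
    expect (iidSamples p (n + 1)) (fun l => (l.map fun s => ψ s l).sum) =
      (n + 1) * expect p fun a => expect (iidSamples p n) fun l => ψ a (a ::ₘ l) := by
  induction n generalizing ψ with
  | zero =>
    rw [expect_iidSamples_succ]
    simp [iidSamples, expect_pure]
  | succ n ih =>
    rw [expect_iidSamples_succ]
    simp only [List.map_cons, List.sum_cons, expect_add]
    have h1 : ∀ a, expect (iidSamples p (n + 1))
        (fun l => (l.map fun s => ψ s (a :: l : List β)).sum) =
        (n + 1) * expect p fun b => expect (iidSamples p n) fun l => ψ b (a ::ₘ b ::ₘ l) :=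
      fun a => ih fun s m => ψ s (a ::ₘ m)
    simp only [h1, expect_const_mul]
    rw [expect_comm p p]
    have h2 : ∀ b, (expect p fun a => expect (iidSamples p n) fun l => ψ b (a ::ₘ b ::ₘ l)) =
        expect (iidSamples p (n + 1)) fun l => ψ b (b ::ₘ l) := by
      intro b
      rw [expect_iidSamples_succ]
      simp only [← Multiset.cons_coe, Multiset.cons_swap b]
    simp only [h2, ← Multiset.cons_coe]
    push_cast
    ring

theorem expect_iidSamples_prod (p : PMF β) (n : ℕ) (z : β → ℝ≥0∞) :
    expect (iidSamples p n) (fun l => (l.map z).prod) = expect p z ^ n := by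
  induction n with
  | zero => simp [iidSamples, expect_pure]
  | succ n ih =>
    rw [expect_iidSamples_succ]
    simp only [List.map_cons, List.prod_cons, expect_const_mul, ih, expect_mul_const, pow_succ']

end Expectation

/-! ### Product distributions and matroid rank -/

section Rank

variable {α : Type*}

/-- The rank of a set as a natural number; the matroids here have a finite carrier, so that no
information is lost. -/
def rk (M : Matroid α) (X : Set α) : ℕ := (M.eRk X).toNat

theorem rk_empty (M : Matroid α) : rk M ∅ = 0 := by simp [rk]

theorem rk_insert_of_mem_closure (M : Matroid α) {e : α} {X : Set α} (h : e ∈ M.closure X) :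
    rk M (insert e X) = rk M X := by
  rw [rk, rk, ← M.eRk_closure_eq (insert e X), M.closure_insert_eq_of_mem_closure h,
    M.eRk_closure_eq]

theorem rk_restrict (M : Matroid α) {C X : Set α} (h : X ⊆ C) : rk (M.restrict C) X = rk M X := by
  rw [rk, rk, M.restrict_eRk_eq h]

end Rank

section ActiveSet

variable {α : Type*} [Fintype α]

open Classical in
/-- Summing a product over all subsets amounts to choosing, for each coordinate independently,
whether it belongs to the subset. -/
theorem sum_set_prod_ite (u v : α → ℝ≥0∞) :
    ∑ S : Set α, ∏ e, (if e ∈ S then u e else v e) = ∏ e, (u e + v e) := by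
  rw [Fintype.prod_add]
  symm
  refine Fintype.sum_equiv Fintype.finsetEquivSet _ _ fun t => ?_
  simp only [Fintype.finsetEquivSet_apply, Finset.mem_coe]
  rw [Finset.prod_ite]
  congr 1
  · congr 1; ext e; simp
  · congr 1; ext e; simp

theorem ofReal_add_ofReal_one_sub (t : unitInterval) :
    ENNReal.ofReal t + ENNReal.ofReal (1 - t) = 1 := by
  rw [← ENNReal.ofReal_add t.2.1 (sub_nonneg.2 t.2.2)]
  simp

theorem expect_activeDist (x : α → unitInterval) (f : Set α → ℝ≥0∞) :
    expect (activeDist x) f = ∑ S, activeWeight x S * f S := by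
  rw [expect, tsum_fintype]
  rfl

theorem activeDist_map_inter (x : α → unitInterval) (C : Set α) :
    (activeDist x).map (fun R => R ∩ C) = activeDist (restrictVec x C) := by
  classical
  ext S
  rw [PMF.map_apply, tsum_fintype]
  change ∑ R : Set α, (if S = R ∩ C then activeWeight x R else 0) =
    activeWeight (restrictVec x C) S
  by_cases hS : S ⊆ C
  · have h : ∀ R : Set α, (if S = R ∩ C then activeWeight x R else 0) =
        ∏ e, if e ∈ R then (if e ∈ C then if e ∈ S then ENNReal.ofReal (x e) else 0
            else ENNReal.ofReal (x e))
          else (if e ∈ C then if e ∈ S then 0 else ENNReal.ofReal (1 - x e)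
            else ENNReal.ofReal (1 - x e)) := by
      intro R
      split_ifs with hR
      · refine Finset.prod_congr rfl fun e _ => ?_
        have : e ∈ S ↔ e ∈ R ∧ e ∈ C := by rw [hR]; rfl
        by_cases h1 : e ∈ R <;> by_cases h2 : e ∈ C <;> simp [h1, h2, this]
      · obtain ⟨e, he⟩ : ∃ e, ¬ (e ∈ S ↔ e ∈ R ∩ C) := by
          by_contra! h
          exact hR (Set.ext h)
        symm
        refine Finset.prod_eq_zero (Finset.mem_univ e) ?_
        have h3 := @hS e
        by_cases h1 : e ∈ R <;> by_cases h2 : e ∈ C <;> by_cases h4 : e ∈ S <;> simp_all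
    rw [Finset.sum_congr rfl fun R _ => h R, sum_set_prod_ite]
    refine Finset.prod_congr rfl fun e _ => ?_
    have h3 := @hS e
    by_cases h2 : e ∈ C <;> by_cases h4 : e ∈ S <;>
      simp_all [restrictVec, ofReal_add_ofReal_one_sub]
  · obtain ⟨e, heS, heC⟩ := Set.not_subset.1 hS
    rw [Finset.sum_eq_zero]
    · symm
      refine Finset.prod_eq_zero (Finset.mem_univ e) ?_
      simp [heS, heC, restrictVec]
    · intro R _
      rw [if_neg]
      rintro rfl
      exact heC heS.2

open Classical in
theorem expect_activeDist_mem (x : α → unitInterval) (e : α) :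
    (expect (activeDist x) fun S => if e ∈ S then 1 else 0) = ENNReal.ofReal (x e) := by
  rw [expect_activeDist]
  have h : ∀ S : Set α, activeWeight x S * (if e ∈ S then 1 else 0) =
      ∏ e', if e' ∈ S then ENNReal.ofReal (x e')
        else if e' = e then 0 else ENNReal.ofReal (1 - x e') := by
    intro S
    split_ifs with hS
    · rw [mul_one]
      refine Finset.prod_congr rfl fun e' _ => ?_
      by_cases h : e' = e
      · simp [h, hS]
      · simp [h]
    · rw [mul_zero]
      symm
      exact Finset.prod_eq_zero (Finset.mem_univ e) (by simp [hS])
  rw [Finset.sum_congr rfl fun S _ => h S, sum_set_prod_ite, Finset.prod_eq_single e]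
  · simp
  · intro b _ hb
    simp [hb, ofReal_add_ofReal_one_sub]
  · simp

theorem coe_rk (M : Matroid α) (X : Set α) : (rk M X : ℕ∞) = M.eRk X :=
  ENat.natCast_toNat (by
    rw [Matroid.eRk_ne_top_iff]
    exact M.isRkFinite_of_finite X.toFinite)

theorem rk_mono (M : Matroid α) {X Y : Set α} (h : X ⊆ Y) : rk M X ≤ rk M Y := by
  have := M.eRk_mono h
  rw [← coe_rk, ← coe_rk] at this
  exact_mod_cast this

theorem rk_insert_of_notMem_closure (M : Matroid α) {e : α} {X : Set α} (he : e ∈ M.E)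
    (h : e ∉ M.closure X) : rk M (insert e X) = rk M X + 1 := by
  have := Matroid.eRk_insert_eq_add_one (M := M) (X := X) ⟨he, h⟩
  rw [← coe_rk, ← coe_rk] at this
  exact_mod_cast this

theorem rk_le_ncard (M : Matroid α) (X : Set α) : rk M X ≤ X.ncard := by
  have := M.eRk_le_encard X
  rw [← coe_rk, ← X.toFinite.cast_ncard_eq] at this
  exact_mod_cast this

theorem one_le_rk_of_mem (M : Matroid α) [M.Loopless] {e : α} {X : Set α} (he : e ∈ M.E)
    (heX : e ∈ X) : 1 ≤ rk M X := by
  have h := M.eRk_mono (Set.singleton_subset_iff.2 heX)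
  rw [Matroid.eRk_singleton_eq he, ← coe_rk] at h
  exact_mod_cast h

theorem sum_le_of_mem_smul_matroidPolytope (M : Matroid α) {l : ℝ} (hl : 0 ≤ l) {v : α → ℝ}
    (hv : v ∈ l • matroidPolytope M) (C : Set α) :
    ∑ e, C.indicator v e ≤ l * rk M C := by
  classical
  obtain ⟨w, hw, rfl⟩ := hv
  have key : matroidPolytope M ⊆ {w : α → ℝ | ∑ e, C.indicator w e ≤ rk M C} := by
    refine convexHull_min ?_ ?_
    · rintro _ ⟨I, hI, rfl⟩
      have h1 : ∀ e, C.indicator (I.indicator (1 : α → ℝ)) e = if e ∈ I ∩ C then 1 else 0 := by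
        intro e
        by_cases h1 : e ∈ I <;> by_cases h2 : e ∈ C <;> simp [h1, h2]
      have h2 : (I ∩ C).ncard ≤ rk M C := by
        have h := (hI.inter_right C).encard_le_eRk_of_subset Set.inter_subset_right
        rw [← coe_rk, ← (I ∩ C).toFinite.cast_ncard_eq] at h
        exact_mod_cast h
      simp only [Set.mem_ofPred_eq, h1]
      rw [Finset.sum_boole]
      rw [Set.ncard_eq_toFinset_card'] at h2
      refine le_trans (Nat.cast_le.2 (le_of_eq ?_)) (Nat.cast_le.2 h2)
      congr 1
      ext e
      simp
    · have : IsLinearMap ℝ fun w : α → ℝ => ∑ e, C.indicator w e := by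
        constructor
        · intro a b
          rw [Set.indicator_add', ← Finset.sum_add_distrib]
          rfl
        · intro c a
          simp [Finset.mul_sum, Pi.smul_def, Set.indicator_const_mul]
      exact convex_halfSpace_le this _
  have h := key hw
  simp only [Set.mem_ofPred_eq] at h
  calc ∑ e, C.indicator (l • w) e = l * ∑ e, C.indicator w e := by
        rw [Finset.mul_sum]
        refine Finset.sum_congr rfl fun e _ => ?_
        by_cases h2 : e ∈ C <;> simp [h2]
    _ ≤ _ := by gcongr

/-- For `x ∈ l • P_M`, the active elements of `C` have expected rank at most `l * rk C`. -/
theorem expect_rk_le (M : Matroid α) {l : ℝ} (hl : 0 ≤ l) (x : α → unitInterval)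
    (hx : (fun e => (x e : ℝ)) ∈ l • matroidPolytope M) (C : Set α) :
    (expect (activeDist (restrictVec x C)) fun S => (rk M S : ℝ≥0∞)) ≤
      ENNReal.ofReal (l * rk M C) := by
  classical
  calc (expect (activeDist (restrictVec x C)) fun S => (rk M S : ℝ≥0∞))
      ≤ expect (activeDist (restrictVec x C)) fun S => ∑ e, if e ∈ S then 1 else 0 := by
        refine expect_mono _ fun S => ?_
        rw [Finset.sum_boole]
        refine Nat.cast_le.2 ((rk_le_ncard M S).trans (le_of_eq ?_))
        rw [Set.ncard_eq_toFinset_card']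
        congr 1
        ext e
        simp
    _ = ∑ e, ENNReal.ofReal (restrictVec x C e) := by
        rw [expect_sum]
        exact Finset.sum_congr rfl fun e _ => expect_activeDist_mem _ e
    _ = ENNReal.ofReal (∑ e, C.indicator (fun e => (x e : ℝ)) e) := by
        rw [ENNReal.ofReal_sum_of_nonneg]
        · refine Finset.sum_congr rfl fun e _ => ?_
          by_cases h : e ∈ C <;> simp [restrictVec, h]
        · intro e _
          exact Set.indicator_nonneg (fun e _ => (x e).2.1) e
    _ ≤ _ := ENNReal.ofReal_le_ofReal (sum_le_of_mem_smul_matroidPolytope M hl hx C)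

end ActiveSet

/-! ### Rank growth caused by independent samples -/

section Spanned

variable {α : Type*}

open Classical in
/-- The elements that are spanned by `A` together with at least `j` of the given samples. The
samples form a multiset, so that their exchangeability can be used. -/
def spannedOften (M : Matroid α) (j : ℕ) (A : Set α) (l : Multiset (Set α)) : Set α :=
  {e ∈ M.E | j ≤ l.countP fun S => e ∈ M.closure (A ∪ S)}

theorem spannedOften_subset_ground (M : Matroid α) (j : ℕ) (A : Set α) (l : Multiset (Set α)) :
    spannedOften M j A l ⊆ M.E := fun _ h => h.1

theorem spannedOften_mono (M : Matroid α) {j j' : ℕ} (hj : j' ≤ j) {A A' : Set α} (hA : A ⊆ A')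
    (l : Multiset (Set α)) : spannedOften M j A l ⊆ spannedOften M j' A' l := by
  classical
  rintro e ⟨he, h⟩
  refine ⟨he, hj.trans (h.trans ?_)⟩
  rw [Multiset.countP_eq_card_filter, Multiset.countP_eq_card_filter]
  exact Multiset.card_le_card (Multiset.monotone_filter_right l fun S hS =>
    M.closure_subset_closure (Set.union_subset_union_left S hA) hS)

theorem subset_spannedOften (M : Matroid α) {j : ℕ} {A : Set α} (hA : A ⊆ M.E)
    {l : Multiset (Set α)} (hj : j ≤ l.card) : A ⊆ spannedOften M j A l := by
  classical
  intro e he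
  refine ⟨hA he, hj.trans (le_of_eq ?_)⟩
  symm
  rw [Multiset.countP_eq_card]
  intro S _
  exact M.mem_closure_of_mem' (Or.inl he) (hA he)

theorem spannedOften_subset_cons (M : Matroid α) (j : ℕ) (A : Set α) (S : Set α)
    (l : Multiset (Set α)) : spannedOften M j A l ⊆ spannedOften M j A (S ::ₘ l) := by
  classical
  rintro e ⟨he, h⟩
  exact ⟨he, h.trans (Multiset.countP_le_of_le _ (Multiset.le_cons_self l S))⟩

theorem spannedOften_cons_subset (M : Matroid α) (j : ℕ) (A : Set α) (S : Set α)
    (l : Multiset (Set α)) :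
    spannedOften M j A (S ::ₘ l) ⊆ spannedOften M (j - 1) A l := by
  classical
  rintro e ⟨he, h⟩
  refine ⟨he, ?_⟩
  rw [Multiset.countP_cons] at h
  split_ifs at h <;> omega

open Classical in
theorem sum_rk_union_insert_le [Fintype α] (M : Matroid α) {A X : Set α} (hAX : A ⊆ X) {e : α}
    (he : e ∈ M.E) (l : List (Set α)) :
    (l.map fun S => rk M (S ∪ insert e X)).sum +
        (l : Multiset (Set α)).countP (fun S => e ∈ M.closure (A ∪ S)) ≤
      (l.map fun S => rk M (S ∪ X)).sum + l.length := by
  induction l with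
  | nil => simp
  | cons S l ih =>
    rw [← Multiset.cons_coe, Multiset.countP_cons]
    simp only [List.map_cons, List.sum_cons, List.length_cons]
    have h : rk M (S ∪ insert e X) + (if e ∈ M.closure (A ∪ S) then 1 else 0) ≤
        rk M (S ∪ X) + 1 := by
      rw [Set.union_insert]
      split_ifs with h
      · rw [rk_insert_of_mem_closure]
        refine M.closure_subset_closure ?_ h
        exact Set.union_subset (hAX.trans Set.subset_union_right) Set.subset_union_left
      · by_cases h2 : e ∈ M.closure (S ∪ X)
        · rw [rk_insert_of_mem_closure M h2]
          omega
        · rw [rk_insert_of_notMem_closure M he h2]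
    omega

open Classical in
/-- If every element of `U` is spanned by `A` together with at least `j` of the samples `S`, then
adding `U` to `A` increases the rank of `A ∪ S` by at most a fraction `1 - j / |l|` of the increase
of the rank of `A`, on average over the samples. -/
theorem sum_rk_union_le [Fintype α] (M : Matroid α) (A U : Set α) (hU : U ⊆ M.E)
    (l : List (Set α)) (j : ℕ)
    (h : ∀ e ∈ U, j ≤ (l : Multiset (Set α)).countP fun S => e ∈ M.closure (A ∪ S)) :
    (l.map fun S => rk M (S ∪ (U ∪ A))).sum + j * rk M (U ∪ A) + l.length * rk M A ≤
      (l.map fun S => rk M (S ∪ A)).sum + l.length * rk M (U ∪ A) + j * rk M A := by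
  induction U, U.toFinite using Set.Finite.induction_on with
  | empty => simp only [Set.empty_union]; omega
  | @insert e U _ _ ih =>
    have ih := ih ((Set.subset_insert e U).trans hU)
      fun e' he' => h e' (Set.mem_insert_of_mem e he')
    have heE : e ∈ M.E := hU (Set.mem_insert e U)
    have hc := h e (Set.mem_insert e U)
    rw [Set.insert_union]
    by_cases he : e ∈ M.closure (U ∪ A)
    · rw [rk_insert_of_mem_closure M he]
      have h2 : ∀ S, rk M (S ∪ insert e (U ∪ A)) = rk M (S ∪ (U ∪ A)) := by
        intro S
        rw [Set.union_insert, rk_insert_of_mem_closure]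
        exact M.closure_subset_closure Set.subset_union_right he
      simpa only [h2] using ih
    · rw [rk_insert_of_notMem_closure M heE he]
      have h2 := sum_rk_union_insert_le M (A := A) (X := U ∪ A) Set.subset_union_right heE l
      rw [mul_add, mul_add]
      omega

end Spanned

section LinkRank

variable {α : Type*} [Fintype α]

/-- Fresh samples do not profit much from the elements selected by earlier samples: here the
selection `spannedOften M j A l` by `q` samples is compared with the selections by `q + 1` samples,
in which all samples are exchangeable, and the latter are bounded by lowering the threshold. -/
theorem expect_rk_union_spannedOften_le (M : Matroid α) (p : PMF (Set α)) (q j : ℕ) (hj : j ≤ q + 1)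
    (A : Set α) (hA : A ⊆ M.E) :
    (q + 1) * (expect (iidSamples p q) fun l =>
          expect p fun S => (rk M (S ∪ spannedOften M j A l) : ℝ≥0∞)) + (q + 1) * rk M A ≤
      (q + 1) * (expect p fun S => (rk M (S ∪ A) : ℝ≥0∞)) +
        ((q + 1 - j : ℕ) * (expect (iidSamples p q) fun l =>
          (rk M (spannedOften M (j - 1) A l) : ℝ≥0∞)) + j * rk M A) := by
  classical
  set P := iidSamples p (q + 1) with hP
  have hdet : ∀ l ∈ P.support,
      (l.map fun S => (rk M (S ∪ spannedOften M j A l) : ℝ≥0∞)).sum + (q + 1) * rk M A ≤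
        (l.map fun S => (rk M (S ∪ A) : ℝ≥0∞)).sum +
          ((q + 1 - j : ℕ) * rk M (spannedOften M j A l) + j * rk M A) := by
    intro l hl
    have hlen := length_of_mem_support_iidSamples p (q + 1) l hl
    have h := sum_rk_union_le M A (spannedOften M j A l) (spannedOften_subset_ground ..) l j
      fun e he => he.2
    rw [Set.union_eq_self_of_subset_right (subset_spannedOften M hA (by simpa [hlen] using hj)),
      hlen] at h
    obtain ⟨k, hk⟩ := Nat.exists_eq_add_of_le hj
    have h' : (l.map fun S => rk M (S ∪ spannedOften M j A l)).sum + (q + 1) * rk M A ≤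
        (l.map fun S => rk M (S ∪ A)).sum +
          ((q + 1 - j : ℕ) * rk M (spannedOften M j A l) + j * rk M A) := by
      rw [hk, add_mul] at h
      rw [hk, Nat.add_sub_cancel_left, add_mul]
      rw [add_mul] at h
      omega
    have h3 := (Nat.cast_le (α := ℝ≥0∞)).2 h'
    simpa [Nat.cast_list_sum, List.map_map, Function.comp_def] using h3
  have h := expect_mono_of_mem_support hdet
  simp only [expect_add, expect_const, expect_const_mul] at h
  rw [hP, expect_iidSamples_sum p q fun S l => (rk M (S ∪ spannedOften M j A l) : ℝ≥0∞),
    expect_iidSamples_sum p q fun S _ => (rk M (S ∪ A) : ℝ≥0∞)] at h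
  simp only [expect_const] at h
  refine le_trans ?_ (h.trans ?_)
  · gcongr
    rw [expect_comm]
    refine expect_mono _ fun S => expect_mono _ fun l => ?_
    exact Nat.cast_le.2 (rk_mono M (Set.union_subset_union_right S
      (spannedOften_subset_cons M j A S l)))
  · gcongr
    rw [expect_iidSamples_succ]
    refine expect_le_of_le fun S _ => expect_mono _ fun l => ?_
    exact Nat.cast_le.2 (rk_mono M (spannedOften_cons_subset M j A S l))

/-- A bounded sequence cannot grow by a factor `1 + κ` (plus `θ R`) in each of `L` steps. -/
theorem exists_small_growth (a : ℕ → ℝ) {κ θ R : ℝ} (hκ : 0 < κ) (hθ : 0 < θ) (hR : 0 ≤ R)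
    {L : ℕ} (hL : 1 + κ / θ ≤ (1 + κ) ^ L) (h0 : 0 ≤ a 0) (haL : a L ≤ R) :
    ∃ i < L, a (i + 1) ≤ (1 + κ) * a i + θ * R := by
  by_contra! hcon
  -- Otherwise `κ * a i` dominates the solution `θ R ((1 + κ) ^ i - 1)` of the recursion.
  have key : ∀ i ≤ L, θ * R * ((1 + κ) ^ i - 1) ≤ κ * a i ∧
      (1 ≤ i → θ * R * ((1 + κ) ^ i - 1) < κ * a i) := by
    intro i
    induction i with
    | zero => intro _; simpa using mul_nonneg hκ.le h0
    | succ i ih =>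
      intro hi
      have h1 := (ih (by omega)).1
      have h2 := hcon i (by omega)
      have h3 : θ * R * ((1 + κ) ^ (i + 1) - 1) < κ * a (i + 1) := by
        rw [pow_succ]
        nlinarith [mul_lt_mul_of_pos_left h2 hκ]
      exact ⟨h3.le, fun _ => h3⟩
  have hL1 : 1 ≤ L := by
    by_contra! h
    obtain rfl : L = 0 := by omega
    have : 0 < κ / θ := by positivity
    simp at hL
    linarith
  have h1 := (key L le_rfl).2 hL1
  have h2 : κ ≤ θ * ((1 + κ) ^ L - 1) := by
    have : κ / θ ≤ (1 + κ) ^ L - 1 := by linarith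
    rw [div_le_iff₀ hθ] at this
    linarith
  have h3 : κ * R ≤ θ * ((1 + κ) ^ L - 1) * R := mul_le_mul_of_nonneg_right h2 hR
  nlinarith [mul_le_mul_of_nonneg_left haL hκ.le]

end LinkRank

/-! ### The expected rank of an iterated link -/

section StepValue

variable {α : Type*}

/-- The expectation of `F` after one iteration of the link construction that starts from `A`. -/
def stepValue (M : Matroid α) (p : PMF (Set α)) (q m : ℕ) (F : Set α → ℝ≥0∞) (A : Set α) : ℝ≥0∞ :=
  expect (iidSamples p q) fun l => F (spannedOften M m A l)

theorem stepValue_iterate_mono (M : Matroid α) (p : PMF (Set α)) (q m h : ℕ)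
    {F : Set α → ℝ≥0∞} (hF : Monotone F) : Monotone ((stepValue M p q m)^[h] F) := by
  induction h with
  | zero => exact hF
  | succ h ih =>
    rw [Function.iterate_succ_apply']
    intro A B hAB
    exact expect_mono _ fun l => ih (spannedOften_mono M le_rfl hAB l)

end StepValue

section LinkRankBound

variable {α : Type*} [Fintype α]

theorem expect_rk_ne_top {ι : Type*} (M : Matroid α) (p : PMF ι) (X : ι → Set α) :
    (expect p fun i => (rk M (X i) : ℝ≥0∞)) ≠ ∞ :=
  ne_top_of_le_ne_top (ENNReal.natCast_ne_top (rk M Set.univ))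
    (expect_le_of_le fun _ _ => Nat.cast_le.2 (rk_mono M (Set.subset_univ _)))

/-- For some threshold `j` at most `L - 1` below `m`, lowering it once more hardly increases the
expected rank of the selection. For this `j`, the potential `E[rk (S ∪ A)] - (1 - b + κ) * rk A`
grows by at most `θ * rk M` in one iteration. -/
theorem exists_threshold (M : Matroid α) (p : PMF (Set α)) {q m L : ℕ} {b κ θ : ℝ}
    (hmq : m ≤ q) (hLm : L ≤ m) (hb : b * (q + 1) ≤ (m - L + 1 : ℝ)) (hb0 : 0 ≤ b)
    (hκ : 0 < κ) (hθ : 0 < θ) (hL : 1 + κ / θ ≤ (1 + κ) ^ L)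
    {A : Set α} (hA : A ⊆ M.E) :
    ∃ j ≤ m,
      (expect (iidSamples p q) fun l =>
          expect p fun S => (rk M (S ∪ spannedOften M j A l) : ℝ≥0∞)) +
        ENNReal.ofReal (1 - b + κ) * rk M A ≤
      (expect p fun S => (rk M (S ∪ A) : ℝ≥0∞)) +
        ENNReal.ofReal (1 - b + κ) * (expect (iidSamples p q) fun l =>
          (rk M (spannedOften M j A l) : ℝ≥0∞)) + ENNReal.ofReal (θ * rk M M.E) := by
  set t : ℕ → ℝ := fun j => (expect (iidSamples p q) fun l =>
    (rk M (spannedOften M j A l) : ℝ≥0∞)).toReal with ht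
  have htop : ∀ j, (expect (iidSamples p q) fun l =>
      (rk M (spannedOften M j A l) : ℝ≥0∞)) = ENNReal.ofReal (t j) := fun j =>
    (ENNReal.ofReal_toReal (expect_rk_ne_top M _ _)).symm
  have ht0 : ∀ j ≤ q, (rk M A : ℝ) ≤ t j := by
    intro j hj
    have h : (rk M A : ℝ≥0∞) ≤ expect (iidSamples p q) fun l =>
        (rk M (spannedOften M j A l) : ℝ≥0∞) := by
      rw [← expect_const (iidSamples p q) (rk M A : ℝ≥0∞)]
      refine expect_mono_of_mem_support fun l hl => Nat.cast_le.2 (rk_mono M ?_)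
      exact subset_spannedOften M hA
        (by simpa [length_of_mem_support_iidSamples p q l hl] using hj)
    have := ENNReal.toReal_mono (expect_rk_ne_top M _ _) h
    simpa using this
  have htE : ∀ j, t j ≤ rk M M.E := by
    intro j
    have h : (expect (iidSamples p q) fun l => (rk M (spannedOften M j A l) : ℝ≥0∞)) ≤
        rk M M.E :=
      expect_le_of_le fun l _ => Nat.cast_le.2 (rk_mono M (spannedOften_subset_ground ..))
    simpa using ENNReal.toReal_mono (ENNReal.natCast_ne_top _) h
  obtain ⟨i, hiL, hi⟩ := exists_small_growth (fun i => t (m - i) - rk M A) hκ hθ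
    (R := rk M M.E) (Nat.cast_nonneg _) hL (by simpa using ht0 m hmq)
    ((sub_le_self _ (Nat.cast_nonneg _)).trans (htE _))
  refine ⟨m - i, Nat.sub_le _ _, ?_⟩
  have key := expect_rk_union_spannedOften_le M p q (m - i) (by omega) A hA
  rw [htop] at key ⊢
  have hG : (expect (iidSamples p q) fun l =>
      expect p fun S => (rk M (S ∪ spannedOften M (m - i) A l) : ℝ≥0∞)) ≠ ∞ :=
    ne_top_of_le_ne_top (ENNReal.natCast_ne_top (rk M Set.univ))
      (expect_le_of_le fun l _ => expect_le_of_le fun S _ =>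
        Nat.cast_le.2 (rk_mono M (Set.subset_univ _)))
  have hg := expect_rk_ne_top M p fun S => S ∪ A
  rw [← ENNReal.ofReal_toReal hG, ← ENNReal.ofReal_toReal hg] at key ⊢
  set G := (expect (iidSamples p q) fun l =>
      expect p fun S => (rk M (S ∪ spannedOften M (m - i) A l) : ℝ≥0∞)).toReal
  set g := (expect p fun S => (rk M (S ∪ A) : ℝ≥0∞)).toReal
  have hG0 : 0 ≤ G := ENNReal.toReal_nonneg
  have hg0 : 0 ≤ g := ENNReal.toReal_nonneg
  have ht1 : ∀ j, 0 ≤ t j := fun j => ENNReal.toReal_nonneg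
  have hji : m - i - 1 = m - (i + 1) := by omega
  have hb1 : b ≤ 1 := by
    by_contra! h
    have h1 : (m : ℝ) ≤ q := by exact_mod_cast hmq
    have h2 : (0 : ℝ) ≤ L := Nat.cast_nonneg _
    have h3 : (0 : ℝ) ≤ q := Nat.cast_nonneg _
    nlinarith
  have hc0 : 0 ≤ 1 - b + κ := by linarith
  have hj : ((m - i : ℕ) : ℝ) = m - i := Nat.cast_sub (by omega)
  have hj' : ((q + 1 - (m - i) : ℕ) : ℝ) = q + 1 - (m - i) := by
    rw [Nat.cast_sub (by omega), hj]
    push_cast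
    ring
  have keyR : (q + 1) * G + (q + 1) * rk M A ≤
      (q + 1) * g + ((q + 1 - (m - i : ℝ)) * t (m - (i + 1)) + (m - i : ℝ) * rk M A) := by
    have := ENNReal.toReal_mono (by finiteness) key
    rw [ENNReal.toReal_add (by finiteness) (by finiteness),
      ENNReal.toReal_add (by finiteness) (by finiteness),
      ENNReal.toReal_add (by finiteness) (by finiteness)] at this
    simp only [ENNReal.toReal_mul, ENNReal.toReal_ofReal hG0, ENNReal.toReal_ofReal hg0,
      ENNReal.toReal_ofReal (ht1 _), ENNReal.toReal_natCast, hj, hj', hji] at this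
    rwa [show ((q : ℝ≥0∞) + 1).toReal = (q : ℝ) + 1 by
      rw [ENNReal.toReal_add (by finiteness) (by finiteness)]; simp] at this
  have hil : (i : ℝ) + 1 ≤ L := by exact_mod_cast hiL
  have hq : (0 : ℝ) < q + 1 := by positivity
  set a := t (m - i) - rk M A with ha
  have ha0 : 0 ≤ a := sub_nonneg.2 (ht0 _ (by omega))
  have hjb : b * (q + 1) ≤ (m - i : ℝ) := by linarith
  have hR0 : 0 ≤ θ * rk M M.E := by positivity
  have hmi : (m : ℝ) - i ≤ q + 1 := by
    have h1 : (m : ℝ) ≤ q := by exact_mod_cast hmq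
    have h2 : (0 : ℝ) ≤ i := Nat.cast_nonneg _
    linarith
  have hmi0 : (0 : ℝ) ≤ (m : ℝ) - i := by rw [← hj]; positivity
  have h1 : (q + 1) * (G - g) ≤ (q + 1) * ((1 - b + κ) * a + θ * rk M M.E) := by
    calc (q + 1) * (G - g) ≤ (q + 1 - (m - i : ℝ)) * (t (m - (i + 1)) - rk M A) := by linarith
      _ ≤ (q + 1 - (m - i : ℝ)) * ((1 + κ) * a + θ * rk M M.E) :=
        mul_le_mul_of_nonneg_left hi (by linarith)
      _ ≤ (q + 1) * ((1 - b) * ((1 + κ) * a) + θ * rk M M.E) := by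
        have h2 : (0 : ℝ) ≤ (1 + κ) * a := by positivity
        nlinarith [mul_le_mul_of_nonneg_right hjb h2]
      _ ≤ _ := by
        refine mul_le_mul_of_nonneg_left ?_ hq.le
        nlinarith [mul_nonneg hb0 (mul_nonneg hκ.le ha0)]
  have h2 := le_of_mul_le_mul_left h1 hq
  have h3 : G + (1 - b + κ) * rk M A ≤ g + (1 - b + κ) * t (m - i) + θ * rk M M.E := by
    rw [ha] at h2
    linarith
  have h4 := ENNReal.ofReal_le_ofReal h3
  rwa [ENNReal.ofReal_add hG0 (by positivity), ENNReal.ofReal_add (by positivity) hR0,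
    ENNReal.ofReal_add hg0 (mul_nonneg hc0 (ht1 _)), ENNReal.ofReal_mul hc0,
    ENNReal.ofReal_mul hc0, ENNReal.ofReal_natCast] at h4

/-- The expected rank after `h` iterations from `A`, bounded by a potential. The induction peels off
the *first* iteration: since later iterations are monotone in their starting set, the selection
may be enlarged by lowering the threshold in a way that depends on `A`. -/
theorem stepValue_iterate_rk_le (M : Matroid α) (p : PMF (Set α)) {q m L : ℕ} {b κ θ : ℝ}
    (hmq : m ≤ q) (hLm : L ≤ m) (hb : b * (q + 1) ≤ (m - L + 1 : ℝ)) (hb0 : κ ≤ b) (hb1 : b ≤ 1)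
    (hκ : 0 < κ) (hθ : 0 < θ) (hL : 1 + κ / θ ≤ (1 + κ) ^ L) (h : ℕ)
    {A : Set α} (hA : A ⊆ M.E) :
    ENNReal.ofReal (b - κ) * (stepValue M p q m)^[h] (fun A => (rk M A : ℝ≥0∞)) A +
        ENNReal.ofReal (1 - b + κ) * rk M A ≤
      (expect p fun S => (rk M (S ∪ A) : ℝ≥0∞)) + h * ENNReal.ofReal (θ * rk M M.E) := by
  induction h generalizing A with
  | zero =>
    rw [Function.iterate_zero, id, ← add_mul, ← ENNReal.ofReal_add (by linarith) (by linarith)]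
    rw [show b - κ + (1 - b + κ) = 1 by ring, ENNReal.ofReal_one, one_mul]
    refine le_add_right ?_
    rw [← expect_const p (rk M A : ℝ≥0∞)]
    exact expect_mono _ fun S => Nat.cast_le.2 (rk_mono M Set.subset_union_right)
  | succ h ih =>
    obtain ⟨j, hjm, hj⟩ := exists_threshold M p hmq hLm hb (hκ.le.trans hb0) hκ hθ hL hA
    rw [Function.iterate_succ_apply']
    set V := (stepValue M p q m)^[h] (fun A => (rk M A : ℝ≥0∞)) with hV
    have hVmono : Monotone V := stepValue_iterate_mono M p q m h
      fun A B hAB => Nat.cast_le.2 (rk_mono M hAB)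
    have h1 : stepValue M p q m V A ≤
        expect (iidSamples p q) fun l => V (spannedOften M j A l) :=
      expect_mono _ fun l => hVmono (spannedOften_mono M hjm le_rfl l)
    have h2 := expect_mono (iidSamples p q) fun l =>
      ih (spannedOften_subset_ground M j A l)
    simp only [expect_add, expect_const_mul, expect_const] at h2
    have hfin : ENNReal.ofReal (1 - b + κ) * (expect (iidSamples p q) fun l =>
        (rk M (spannedOften M j A l) : ℝ≥0∞)) ≠ ∞ :=
      ENNReal.mul_ne_top ENNReal.ofReal_ne_top (expect_rk_ne_top M _ _)
    refine (ENNReal.add_le_add_iff_right hfin).1 ?_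
    calc _ ≤ (ENNReal.ofReal (b - κ) *
            (expect (iidSamples p q) fun l => V (spannedOften M j A l)) +
            ENNReal.ofReal (1 - b + κ) * (expect (iidSamples p q) fun l =>
              (rk M (spannedOften M j A l) : ℝ≥0∞))) +
            ENNReal.ofReal (1 - b + κ) * rk M A := by
          rw [add_right_comm]
          gcongr
      _ ≤ _ := add_le_add_left h2 _
      _ = ((expect (iidSamples p q) fun l =>
            expect p fun S => (rk M (S ∪ spannedOften M j A l) : ℝ≥0∞)) +
            ENNReal.ofReal (1 - b + κ) * rk M A) + h * ENNReal.ofReal (θ * rk M M.E) := by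
          rw [add_right_comm]
      _ ≤ _ := add_le_add_left hj _
      _ = _ := by
        push_cast
        ring

theorem expect_linkIter_of_step (M : Matroid α) (x : α → unitInterval) (τ : ℝ) {q m : ℕ}
    (hstep : ∀ A, linkStep M x τ q A =
      (iidSamples (activeDist x) q).map fun l : List (Set α) => spannedOften M m A l)
    (h : ℕ) (F : Set α → ℝ≥0∞) :
    expect (linkIter M x τ q h) F = (stepValue M (activeDist x) q m)^[h] F ∅ := by
  induction h generalizing F with
  | zero => exact expect_pure _ _
  | succ h ih =>
    rw [Function.iterate_succ_apply, ← ih, linkIter, expect_bind]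
    simp only [hstep, expect_map]
    rfl

theorem linkStep_eq_map_spannedOften (M : Matroid α) (x : α → unitInterval) {τ : ℝ} (hτ : 0 ≤ τ)
    {q : ℕ} (hq : 0 < q) (A : Set α) :
    linkStep M x τ q A =
      (iidSamples (activeDist x) q).map fun l : List (Set α) =>
        spannedOften M (⌊τ * q⌋₊ + 1) A l := by
  rw [linkStep]
  congr 1
  funext l
  ext e
  simp only [spannedOften, Set.mem_ofPred_eq, Multiset.coe_countP]
  refine and_congr_right fun _ => ?_
  rw [lt_div_iff₀ (by positivity), Nat.succ_le_iff, Nat.floor_lt (by positivity)]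

end LinkRankBound

/-! ### Parameters of the procedure and the rank of a link -/

section Parameters

variable {ρ : ℕ} {ε τ : ℝ}

theorem one_le_log_of_three_le (hρ : 3 ≤ ρ) : 1 ≤ Real.log ρ := by
  rw [Real.le_log_iff_exp_le (by positivity)]
  have h : (3 : ℝ) ≤ ρ := by exact_mod_cast hρ
  linarith [Real.exp_one_lt_d9]

theorem inv_le_log_div (hρ : 3 ≤ ρ) (hε0 : 0 < ε) : 1 / ε ≤ Real.log ρ / ε := by
  gcongr
  exact one_le_log_of_three_le hρ

theorem twenty_le_log_div (hρ : 3 ≤ ρ) (hε0 : 0 < ε) (hε : ε ≤ 1 / 20) :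
    20 ≤ Real.log ρ / ε := by
  refine le_trans ?_ (inv_le_log_div hρ hε0)
  rw [le_div_iff₀ hε0]
  linarith

theorem one_le_log_log_div (hρ : 3 ≤ ρ) (hε0 : 0 < ε) (hε : ε ≤ 1 / 20) :
    1 ≤ Real.log (Real.log ρ / ε) := by
  have h := twenty_le_log_div hρ hε0 hε
  rw [Real.le_log_iff_exp_le (by linarith)]
  linarith [Real.exp_one_lt_d9]

theorem one_le_log_div_cube (hρ : 3 ≤ ρ) (hε0 : 0 < ε) (hε : ε ≤ 1 / 20) :
    1 ≤ Real.log ρ / ε ^ 3 := by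
  rw [one_le_div (by positivity)]
  exact (pow_le_one₀ hε0.le (by linarith)).trans (one_le_log_of_three_le hρ)

/-- The number of iterations is polynomial in `ln ρ / ε`. -/
theorem add_one_maxIter_le_sq (hρ : 3 ≤ ρ) (hε0 : 0 < ε) (hε : ε ≤ 1 / 20) :
    1 + (maxIter ρ ε : ℝ) ≤ (Real.log ρ / ε) ^ 2 := by
  set y := Real.log ρ / ε with hy
  have hy20 : 20 ≤ y := twenty_le_log_div hρ hε0 hε
  have hly := one_le_log_log_div hρ hε0 hε
  have hye : 1 / ε ≤ y := inv_le_log_div hρ hε0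
  have hz0 : 0 ≤ Real.logb (1 + ε) (Real.log ρ / ε ^ 3) :=
    Real.logb_nonneg (by linarith) (one_le_log_div_cube hρ hε0 hε)
  set z := Real.logb (1 + ε) (Real.log ρ / ε ^ 3) with hz
  have hη : (maxIter ρ ε : ℝ) ≤ z + 2 := by
    have h1 : maxIter ρ ε = ⌈1 + z⌉₊ := by
      rw [maxIter, max_eq_right]
      exact Nat.one_le_ceil_iff.2 (by linarith)
    rw [h1]
    linarith [Nat.ceil_lt_add_one (show 0 ≤ 1 + z by linarith)]
  have hlog3 : Real.log (Real.log ρ / ε ^ 3) ≤ 3 * Real.log y := by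
    rw [show (3 : ℝ) * Real.log y = ((3 : ℕ) : ℝ) * Real.log y by norm_num, ← Real.log_pow]
    refine Real.log_le_log (by linarith [one_le_log_div_cube hρ hε0 hε]) ?_
    rw [hy, div_pow]
    gcongr
    exact le_self_pow₀ (one_le_log_of_three_le hρ) (by norm_num)
  have hlog1 : ε * (20 / 21) ≤ Real.log (1 + ε) := by
    refine le_trans ?_ (Real.one_sub_inv_le_log_of_pos (by linarith))
    rw [le_sub_iff_add_le, ← le_sub_iff_add_le', inv_le_iff_one_le_mul₀ (by linarith)]
    nlinarith
  have hlogy : Real.log y ≤ y / 8 + 1.08 := by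
    have h1 : Real.log (y / 8) = Real.log y - 3 * Real.log 2 := by
      rw [Real.log_div (by linarith) (by norm_num), show (8 : ℝ) = 2 ^ 3 by norm_num, Real.log_pow]
      norm_num
    have h2 := Real.log_le_sub_one_of_pos (show 0 < y / 8 by linarith)
    linarith [Real.log_two_lt_d9]
  have hz1 : z ≤ 3.15 * (Real.log y * y) := by
    have hpos : 0 < Real.log (1 + ε) := lt_of_lt_of_le (by positivity) hlog1
    rw [hz, Real.logb, div_le_iff₀ hpos]
    refine hlog3.trans ?_
    have h1 : 1 ≤ y * ε := by rwa [div_le_iff₀ hε0] at hye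
    calc 3 * Real.log y ≤ 3 * Real.log y * (y * ε) := le_mul_of_one_le_right (by linarith) h1
      _ = 3.15 * (Real.log y * y) * (ε * (20 / 21)) := by ring
      _ ≤ _ := by gcongr
  nlinarith [mul_le_mul_of_nonneg_right hlogy (show 0 ≤ y by linarith)]

theorem six_log_le_numSamples_mul (hε0 : 0 < ε) (hτ0 : 0 < τ) :
    6 * Real.log (Real.log ρ / ε) ≤ numSamples ρ τ ε * (τ * ε ^ 2) := by
  have h := Nat.le_ceil (6 / (τ * ε ^ 2) * Real.log (Real.log ρ / ε))
  calc 6 * Real.log (Real.log ρ / ε)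
      = 6 / (τ * ε ^ 2) * Real.log (Real.log ρ / ε) * (τ * ε ^ 2) := by field_simp
    _ ≤ _ := mul_le_mul_of_nonneg_right h (by positivity)

/-- The thresholds between `τ * q` and `(τ - ε) * q` are numerous enough for `sq_le_pow_floor`. -/
theorem five_log_le_floor_mul (hρ : 3 ≤ ρ) (hε0 : 0 < ε) (hε : ε ≤ 1 / 20) (hτ0 : 0 < τ)
    (hτ1 : τ ≤ 1) :
    5 * Real.log (Real.log ρ / ε) ≤ (⌊ε * numSamples ρ τ ε⌋₊ : ℝ) * ε := by
  have h1 := six_log_le_numSamples_mul (ρ := ρ) hε0 hτ0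
  have h2 := Nat.lt_floor_add_one (ε * numSamples ρ τ ε)
  have h3 := one_le_log_log_div hρ hε0 hε
  have h4 : (numSamples ρ τ ε : ℝ) * (τ * ε ^ 2) ≤ numSamples ρ τ ε * ε ^ 2 := by
    gcongr
    exact mul_le_of_le_one_left (by positivity) hτ1
  nlinarith

theorem one_le_mul_numSamples (hρ : 3 ≤ ρ) (hε0 : 0 < ε) (hε : ε ≤ 1 / 20) (hτ0 : 0 < τ)
    (hτ1 : τ ≤ 1) : 1 ≤ ε * numSamples ρ τ ε := by
  have h1 := five_log_le_floor_mul hρ hε0 hε hτ0 hτ1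
  have h2 := one_le_log_log_div hρ hε0 hε
  have h3 := Nat.floor_le (show 0 ≤ ε * (numSamples ρ τ ε : ℝ) by positivity)
  nlinarith

theorem floor_mul_numSamples_lt (hρ : 3 ≤ ρ) (hε0 : 0 < ε) (hε : ε ≤ 1 / 20) (hτ0 : 0 < τ)
    (hτ1 : τ ≤ 1 - ε) : ⌊τ * numSamples ρ τ ε⌋₊ + 1 ≤ numSamples ρ τ ε := by
  have h1 := one_le_mul_numSamples hρ hε0 hε hτ0 (by linarith)
  have h2 := Nat.floor_le (show 0 ≤ τ * (numSamples ρ τ ε : ℝ) by positivity)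
  have h3 : (0 : ℝ) ≤ numSamples ρ τ ε := Nat.cast_nonneg _
  have h4 : ((⌊τ * numSamples ρ τ ε⌋₊ + 1 : ℕ) : ℝ) ≤ numSamples ρ τ ε := by
    push_cast
    nlinarith
  exact_mod_cast h4

/-- Growth by a factor `1 + ε / 2` at each of `⌊ε * q⌋` thresholds exceeds the number of iterations,
by `add_one_maxIter_le_sq`. -/
theorem sq_le_pow_floor (hρ : 3 ≤ ρ) (hε0 : 0 < ε) (hε : ε ≤ 1 / 20) (hτ0 : 0 < τ)
    (hτ1 : τ ≤ 1) :
    (Real.log ρ / ε) ^ 2 ≤ (1 + ε / 2) ^ ⌊ε * numSamples ρ τ ε⌋₊ := by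
  have h20 := twenty_le_log_div hρ hε0 hε
  rw [← Real.log_le_log_iff (by positivity) (by positivity), Real.log_pow, Real.log_pow]
  have h1 := five_log_le_floor_mul hρ hε0 hε hτ0 hτ1
  have h2 : ε * (2 / 5) ≤ Real.log (1 + ε / 2) := by
    refine le_trans ?_ (Real.one_sub_inv_le_log_of_pos (by linarith))
    rw [le_sub_iff_add_le, ← le_sub_iff_add_le', inv_le_iff_one_le_mul₀ (by linarith)]
    nlinarith
  have h3 : (0 : ℝ) ≤ (⌊ε * numSamples ρ τ ε⌋₊ : ℝ) := by positivity
  push_cast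
  nlinarith [mul_le_mul_of_nonneg_left h2 h3]

end Parameters

theorem expect_stopDist (ε : ℝ≥0) (η : ℕ) (hη : 1 ≤ η) (F : ℕ → ℝ≥0∞) :
    expect (stopDist ε η hη) F = ∑ h ∈ Finset.Icc 1 η, (stopWeight ε η h : ℝ≥0∞) * F h := by
  rw [expect, tsum_eq_sum (s := Finset.Icc 1 η)]
  · refine Finset.sum_congr rfl fun h hh => ?_
    rw [stopDist, PMF.ofFinset_apply, if_pos hh]
  · intro h hh
    rw [stopDist, PMF.ofFinset_apply, if_neg hh, zero_mul]

theorem mem_Icc_of_mem_support_stopDist {ε : ℝ≥0} {η : ℕ} {hη : 1 ≤ η} {h : ℕ}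
    (hh : h ∈ (stopDist ε η hη).support) : h ∈ Finset.Icc 1 η := by
  rw [stopDist, PMF.mem_support_ofFinset_iff] at hh
  exact hh.1

section LinkRank

variable {α : Type*} [Fintype α]

/-- The link constructed by `singleOcrsLink` has expected rank at most `(1 - ε) * rk M`. -/
theorem expect_rk_singleOcrsLink_le (M : Matroid α) (x : α → unitInterval) {ρ : ℕ} (hρ : 3 ≤ ρ)
    {ε l : ℝ} (hε0 : 0 < ε) (hε : ε ≤ 1 / 20) (hl0 : 0 < l) (hl : l ≤ 1 - 4 * ε)
    (hx : (expect (activeDist x) fun S => (rk M S : ℝ≥0∞)) ≤ ENNReal.ofReal (l * rk M M.E)) :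
    (expect (singleOcrsLink M x ρ ((1 - ε) * (l + 4 * ε)) ε) fun A => (rk M A : ℝ≥0∞)) ≤
      ENNReal.ofReal (1 - ε) * rk M M.E := by
  rw [singleOcrsLink, expect_bind]
  refine expect_le_of_le fun h hh => ?_
  have hhη := (Finset.mem_Icc.1 (mem_Icc_of_mem_support_stopDist hh)).2
  set τ := (1 - ε) * (l + 4 * ε) with hτ
  set q := numSamples ρ τ ε with hq
  set η := maxIter ρ ε with hη
  have hτ0 : 3 * ε ≤ τ := by nlinarith
  have hτ1 : τ ≤ 1 - ε := by nlinarith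
  have hτpos : 0 < τ := by linarith
  set L := ⌊ε * q⌋₊ with hL
  have hLq : (L : ℝ) ≤ ε * q := Nat.floor_le (by positivity)
  set m := ⌊τ * q⌋₊ + 1 with hm
  have hmq : m ≤ q := floor_mul_numSamples_lt hρ hε0 hε hτpos hτ1
  have hq0 : 0 < q := by omega
  have hm1 : τ * q ≤ m := by
    rw [hm]
    push_cast
    exact (Nat.lt_floor_add_one _).le
  have hLm : L ≤ m := by
    have h2 : (L : ℝ) ≤ m := hLq.trans (le_trans (by gcongr; linarith) hm1)
    exact_mod_cast h2
  have hη1 : (1 : ℝ) ≤ η := by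
    have : 1 ≤ η := le_max_left _ _
    exact_mod_cast this
  have hηpos : (0 : ℝ) < η := by linarith
  have hgrow : 1 + (ε / 2) / (ε / (2 * η)) ≤ (1 + ε / 2) ^ L := by
    have h1 : (ε / 2) / (ε / (2 * η)) = η := by
      field_simp
    rw [h1]
    exact (add_one_maxIter_le_sq hρ hε0 hε).trans
      (sq_le_pow_floor hρ hε0 hε hτpos (by linarith))
  -- With `κ = ε / 2` and `θ = ε / (2 * η)`, the errors of all iterations add up to `ε / 2 * rk M`,
  -- and `κ / θ = η`.
  have main := stepValue_iterate_rk_le M (activeDist x) (b := τ - ε) hmq hLm (by nlinarith)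
    (by linarith) (by linarith) (half_pos hε0) (by positivity) hgrow h (Set.empty_subset M.E)
  rw [← expect_linkIter_of_step M x τ fun A => linkStep_eq_map_spannedOften M x hτpos.le hq0 A]
    at main
  simp only [rk_empty, Nat.cast_zero, mul_zero, add_zero, Set.union_empty] at main
  set r : ℝ := ((rk M M.E : ℕ) : ℝ) with hr
  have hr0 : 0 ≤ r := Nat.cast_nonneg _
  have hpos : 0 < τ - ε - ε / 2 := by linarith
  have hfin : ENNReal.ofReal (τ - ε - ε / 2) *
      (expect (linkIter M x τ q h) fun A => (rk M A : ℝ≥0∞)) ≤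
      ENNReal.ofReal (τ - ε - ε / 2) * (ENNReal.ofReal (1 - ε) * rk M M.E) := by
    refine (main.trans (add_le_add_left hx _)).trans ?_
    rw [← ENNReal.ofReal_natCast (rk M M.E), ← ENNReal.ofReal_natCast h,
      ← ENNReal.ofReal_mul (Nat.cast_nonneg _), ← ENNReal.ofReal_mul (by linarith),
      ← ENNReal.ofReal_mul hpos.le, ← ENNReal.ofReal_add (by positivity) (by positivity)]
    refine ENNReal.ofReal_le_ofReal ?_
    have h1 : (h : ℝ) * (ε / (2 * η) * r) ≤ ε / 2 * r := by
      have h2 : (h : ℝ) ≤ η := by exact_mod_cast hhη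
      calc (h : ℝ) * (ε / (2 * η) * r) ≤ η * (ε / (2 * η) * r) := by gcongr
        _ = ε / 2 * r := by field_simp
    -- This is where the choice `τ = (1 - ε) * (l + 4 * ε)` with `l ≤ 1 - 4 * ε` is used.
    have h3 : l + ε / 2 ≤ (τ - ε - ε / 2) * (1 - ε) := by
      rw [hτ]
      nlinarith [mul_nonneg hε0.le (show 0 ≤ 1 - 4 * ε - l by linarith),
        mul_nonneg (mul_nonneg hε0.le hε0.le) (show 0 ≤ l by linarith),
        mul_nonneg (mul_nonneg hε0.le hε0.le) hε0.le, mul_nonneg hε0.le hε0.le]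
    nlinarith [mul_le_mul_of_nonneg_right h3 hr0]
  exact (ENNReal.mul_le_mul_iff_right (ENNReal.ofReal_pos.2 hpos).ne' ENNReal.ofReal_ne_top).1 hfin

end LinkRank

/-! ### Chernoff bound and random stopping -/

section Chernoff

theorem exp_neg_le_quadratic {ε : ℝ} (hε0 : 0 ≤ ε) : Real.exp (-ε) ≤ 1 - ε + ε ^ 2 / 2 := by
  rw [Real.exp_neg]
  have h := Real.quadratic_le_exp_of_nonneg hε0
  refine (inv_anti₀ (by positivity) h).trans ?_
  rw [inv_le_iff_one_le_mul₀ (by positivity)]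
  nlinarith [sq_nonneg (ε ^ 2)]

open Classical in
/-- A Chernoff bound for the lower tail: if an event has probability at least `τ`, then it is
unlikely to occur in at most a fraction `(1 - ε) * τ` of the independent samples. -/
theorem expect_countP_le {β : Type*} (p : PMF β) (P : β → Prop) (q : ℕ) {τ ε : ℝ} (hτ : 0 ≤ τ)
    (hε : 0 ≤ ε) (h : ENNReal.ofReal τ ≤ expect p fun b => if P b then 1 else 0) :
    (expect (iidSamples p q) fun l =>
        if (l.countP (fun b => decide (P b)) : ℝ) ≤ (1 - ε) * τ * q then 1 else 0) ≤
      ENNReal.ofReal (Real.exp (-(ε ^ 2 / 2 * τ * q))) := by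
  set z : β → ℝ≥0∞ := fun b => if P b then ENNReal.ofReal (Real.exp (-ε)) else 1 with hz
  have hc0 : 0 ≤ 1 - Real.exp (-ε) := by
    rw [sub_nonneg, Real.exp_le_one_iff]
    linarith
  have hEz : expect p z ≤ ENNReal.ofReal (Real.exp (-((1 - Real.exp (-ε)) * τ))) := by
    have h1 : expect p z + ENNReal.ofReal (1 - Real.exp (-ε)) *
        (expect p fun b => if P b then 1 else 0) = 1 := by
      rw [← expect_const_mul, ← expect_add]
      refine Eq.trans ?_ (expect_const p 1)
      congr 1
      funext b
      by_cases hb : P b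
      · simp only [hz, hb, if_true, mul_one]
        rw [← ENNReal.ofReal_add (Real.exp_pos _).le hc0]
        simp
      · simp [hz, hb]
    have h2 : expect p z + ENNReal.ofReal ((1 - Real.exp (-ε)) * τ) ≤ 1 := by
      rw [← h1, ENNReal.ofReal_mul hc0]
      gcongr
    refine (ENNReal.le_sub_of_add_le_right ENNReal.ofReal_ne_top h2).trans ?_
    rw [← ENNReal.ofReal_one, ← ENNReal.ofReal_sub _ (mul_nonneg hc0 hτ)]
    exact ENNReal.ofReal_le_ofReal (Real.one_sub_le_exp_neg _)
  have hprod : ∀ l : List β, (l.map z).prod =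
      ENNReal.ofReal (Real.exp (-ε * l.countP fun b => decide (P b))) := by
    intro l
    induction l with
    | nil => simp
    | cons b l ih =>
      rw [List.map_cons, List.prod_cons, ih, List.countP_cons]
      by_cases hb : P b
      · simp only [hz, hb, if_true, decide_true]
        rw [← ENNReal.ofReal_mul (Real.exp_pos _).le, ← Real.exp_add]
        congr 2
        push_cast
        ring
      · simp [hz, hb]
  have hmarkov : ∀ l : List β,
      (if (l.countP (fun b => decide (P b)) : ℝ) ≤ (1 - ε) * τ * q then 1 else 0) ≤
        ENNReal.ofReal (Real.exp (ε * ((1 - ε) * τ * q))) * (l.map z).prod := by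
    intro l
    split_ifs with hl
    · rw [hprod, ← ENNReal.ofReal_mul (Real.exp_pos _).le, ← Real.exp_add, ← ENNReal.ofReal_one]
      refine ENNReal.ofReal_le_ofReal (Real.one_le_exp ?_)
      nlinarith [mul_le_mul_of_nonneg_left hl hε]
    · exact zero_le
  refine (expect_mono _ hmarkov).trans ?_
  rw [expect_const_mul, expect_iidSamples_prod]
  refine (mul_le_mul_right (pow_le_pow_left' hEz q) _).trans ?_
  rw [← ENNReal.ofReal_pow (Real.exp_pos _).le, ← Real.exp_nat_mul,
    ← ENNReal.ofReal_mul (Real.exp_pos _).le, ← Real.exp_add]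
  refine ENNReal.ofReal_le_ofReal (Real.exp_le_exp.2 ?_)
  have h3 := exp_neg_le_quadratic hε
  have h4 : (0 : ℝ) ≤ τ * q := by positivity
  nlinarith [mul_le_mul_of_nonneg_right h3 h4]

end Chernoff

section StopWeight

theorem stopWeight_add_two (ε : ℝ≥0) (η h : ℕ) :
    stopWeight ε η (h + 2) = ε * ((1 + ε) ^ h * (1 / (1 + ε) ^ (η - 1))) := by
  rw [stopWeight, Fin.sum_univ_eq_sum_range (stopWeight ε η) (h + 2), sum_stopWeight]

theorem stopWeight_succ_le {ε : ℝ≥0} (hε : ε ≤ 1) (η : ℕ) {h : ℕ} (hh : 1 ≤ h) :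
    stopWeight ε η (h + 1) ≤ stopWeight ε η h + ε * stopWeight ε η (h + 1) := by
  obtain ⟨k, rfl⟩ := Nat.exists_eq_add_of_le' hh
  rcases k with _ | k
  · rw [stopWeight_add_two]
    refine le_add_right ?_
    rw [stopWeight, pow_zero, one_mul]
    exact mul_le_of_le_one_left' hε
  · rw [stopWeight_add_two, stopWeight_add_two, pow_succ, ← NNReal.coe_le_coe]
    push_cast
    have : (0 : ℝ) ≤ ε ^ 3 * ((1 + ε) ^ k * (1 / (1 + ε) ^ (η - 1))) := by positivity
    have : (0 : ℝ) ≤ ε ^ 2 * ((1 + ε) ^ k * (1 / (1 + ε) ^ (η - 1))) := by positivity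
    nlinarith

/-- Summation by parts: a random stopping time with weights `stopWeight` sees little of the
decrease `d h ≤ u h - u (h + 1)` of a sequence `u`, since consecutive weights differ by a factor of
at most `1 + ε`. -/
theorem expect_stopDist_decrement_le {ε : ℝ≥0} (hε : ε ≤ 1) {η : ℕ} (hη : 1 ≤ η)
    {u d : ℕ → ℝ≥0∞} (hu : ∀ h, u h ≤ 1) (hd : ∀ h, d h + u (h + 1) ≤ u h) :
    expect (stopDist ε η hη) d ≤ stopWeight ε η 1 + ε * expect (stopDist ε η hη) u := by
  rw [expect_stopDist, expect_stopDist]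
  have key : ∀ H, 1 ≤ H →
      ∑ h ∈ Finset.Icc 1 H, (stopWeight ε η h : ℝ≥0∞) * d h + stopWeight ε η H * u (H + 1) ≤
        stopWeight ε η 1 + ε * ∑ h ∈ Finset.Icc 1 H, (stopWeight ε η h : ℝ≥0∞) * u h := by
    intro H hH
    induction H, hH using Nat.le_induction with
    | base =>
      simp only [Finset.Icc_self, Finset.sum_singleton]
      refine le_add_right ?_
      rw [← mul_add]
      exact mul_le_of_le_one_right' ((hd 1).trans (hu 1))
    | succ H hH ih =>
      rw [Finset.sum_Icc_succ_top (by omega), Finset.sum_Icc_succ_top (by omega)]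
      have hw : (stopWeight ε η (H + 1) : ℝ≥0∞) ≤
          stopWeight ε η H + ε * stopWeight ε η (H + 1) := by
        exact_mod_cast stopWeight_succ_le hε η hH
      calc _ = ∑ h ∈ Finset.Icc 1 H, (stopWeight ε η h : ℝ≥0∞) * d h +
            stopWeight ε η (H + 1) * (d (H + 1) + u (H + 1 + 1)) := by ring
        _ ≤ ∑ h ∈ Finset.Icc 1 H, (stopWeight ε η h : ℝ≥0∞) * d h +
            (stopWeight ε η H + ε * stopWeight ε η (H + 1)) * u (H + 1) := by
          gcongr
          exact hd _
        _ = (∑ h ∈ Finset.Icc 1 H, (stopWeight ε η h : ℝ≥0∞) * d h +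
            stopWeight ε η H * u (H + 1)) + ε * (stopWeight ε η (H + 1) * u (H + 1)) := by ring
        _ ≤ _ := add_le_add_left ih _
        _ = _ := by ring
  exact (le_add_right le_rfl).trans (key η hη)

end StopWeight

/-! ### Elements spanned by a link -/

section Indicator

variable {β : Type*}

theorem expect_ite_add_expect_ite_not (p : PMF β) (P : β → Prop) [DecidablePred P] :
    (expect p fun b => if P b then 1 else 0) + (expect p fun b => if ¬ P b then 1 else 0) = 1 := by
  rw [← expect_add]
  refine Eq.trans ?_ (expect_const p 1)
  congr 1
  funext b
  by_cases h : P b <;> simp [h]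

theorem expect_ite_le_one (p : PMF β) (P : β → Prop) [DecidablePred P] :
    (expect p fun b => if P b then 1 else 0) ≤ 1 :=
  expect_le_of_le fun b _ => by split_ifs <;> simp

end Indicator

theorem one_le_maxIter (ρ : ℕ) (ε : ℝ) : 1 ≤ maxIter ρ ε := le_max_left _ _

section LinkFreeness

variable {α : Type*} [Fintype α]

theorem subset_of_mem_support_linkIter (M : Matroid α) (x : α → unitInterval) (τ : ℝ) (q h : ℕ)
    {A : Set α} (hA : A ∈ (linkIter M x τ q h).support) : A ⊆ M.E := by
  rcases h with _ | h
  · simp only [linkIter, PMF.support_pure, Set.mem_singleton_iff] at hA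
    simp [hA]
  · simp only [linkIter, linkStep, PMF.mem_support_bind_iff, PMF.mem_support_map_iff] at hA
    obtain ⟨-, -, l, -, rfl⟩ := hA
    exact fun e he => he.1

theorem subset_of_mem_support_singleOcrsLink (M : Matroid α) (x : α → unitInterval) {ρ : ℕ}
    {τ ε : ℝ} {A : Set α} (hA : A ∈ (singleOcrsLink M x ρ τ ε).support) : A ⊆ M.E := by
  rw [singleOcrsLink, PMF.mem_support_bind_iff] at hA
  obtain ⟨h, -, hA⟩ := hA
  exact subset_of_mem_support_linkIter M x _ _ h hA

/-- Iterations only enlarge the link. -/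
theorem subset_of_mem_support_linkStep (M : Matroid α) (x : α → unitInterval) {τ : ℝ} (hτ : 0 ≤ τ)
    {q : ℕ} (hq : ⌊τ * q⌋₊ + 1 ≤ q) {A A' : Set α} (hA : A ⊆ M.E)
    (hA' : A' ∈ (linkStep M x τ q A).support) : A ⊆ A' := by
  rw [linkStep_eq_map_spannedOften M x hτ (by omega), PMF.mem_support_map_iff] at hA'
  obtain ⟨l, hl, rfl⟩ := hA'
  exact subset_spannedOften M hA
    (by simpa [length_of_mem_support_iidSamples _ _ _ hl] using hq)

open Classical in
/-- An element that is spanned with probability more than `τ` is unlikely to be missed by the next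
iteration. -/
theorem expect_linkStep_notMem_le (M : Matroid α) (x : α → unitInterval) {τ ε : ℝ} (hτ : 0 ≤ τ)
    (hε0 : 0 ≤ ε) {q : ℕ} (hq : 0 < q) (A : Set α) {e : α} (he : e ∈ M.E)
    (h : ENNReal.ofReal τ ≤
      expect (activeDist x) fun S => if e ∈ M.closure (A ∪ S) then 1 else 0) :
    (expect (linkStep M x ((1 - ε) * τ) q A) fun A' => if e ∉ A' then 1 else 0) ≤
      ENNReal.ofReal (Real.exp (-(ε ^ 2 / 2 * τ * q))) := by
  rw [linkStep, expect_map]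
  refine le_trans (expect_mono _ fun l => ?_)
    (expect_countP_le (activeDist x) (fun S => e ∈ M.closure (A ∪ S)) q hτ hε0 h)
  have hqr : (0 : ℝ) < q := by exact_mod_cast hq
  have hiff : (e ∉ {e ∈ M.E | (1 - ε) * τ <
      (l.countP fun S => decide (e ∈ M.closure (A ∪ S)) : ℕ) / (q : ℝ)}) ↔
      (l.countP (fun S => decide (e ∈ M.closure (A ∪ S))) : ℝ) ≤ (1 - ε) * τ * q := by
    simp only [Set.mem_ofPred_eq, he, true_and, not_lt, div_le_iff₀ hqr]
  simp only [hiff]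
  exact le_rfl

open Classical in
/-- A bound on the probability that `e` stays outside of the link `A` although it is spanned by `A`
and the active elements. If `e` is spanned with probability more than `τ` given `A`, then it very
likely enters the next iterate, and the iteration rarely ends just before that. -/
theorem expect_singleOcrsLink_spanned_le (M : Matroid α) (x : α → unitInterval) {ρ : ℕ} {τ ε : ℝ}
    (hτ : 0 ≤ τ) (hε0 : 0 ≤ ε) (hε1 : ε ≤ 1)
    (hq : ⌊(1 - ε) * τ * numSamples ρ ((1 - ε) * τ) ε⌋₊ + 1 ≤ numSamples ρ ((1 - ε) * τ) ε)
    {e : α} (he : e ∈ M.E) :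
    (expect (singleOcrsLink M x ρ ((1 - ε) * τ) ε) fun A => if e ∉ A then
        expect (activeDist x) fun S => if e ∈ M.closure (A ∪ S) then 1 else 0 else 0) ≤
      ENNReal.ofReal (τ + ε) * (expect (singleOcrsLink M x ρ ((1 - ε) * τ) ε) fun A =>
        if e ∉ A then 1 else 0) +
      (stopWeight ε.toNNReal (maxIter ρ ε) 1 +
        ENNReal.ofReal (Real.exp (-(ε ^ 2 / 2 * τ * numSamples ρ ((1 - ε) * τ) ε)))) := by
  set q := numSamples ρ ((1 - ε) * τ) ε with hqdef
  set δ := ENNReal.ofReal (Real.exp (-(ε ^ 2 / 2 * τ * q))) with hδ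
  have hτ' : 0 ≤ (1 - ε) * τ := mul_nonneg (by linarith) hτ
  have hq0 : 0 < q := (Nat.succ_pos _).trans_le hq
  set u : ℕ → ℝ≥0∞ := fun h =>
    expect (linkIter M x ((1 - ε) * τ) q h) fun A => if e ∉ A then 1 else 0 with hu
  set d : ℕ → ℝ≥0∞ := fun h =>
    expect (linkIter M x ((1 - ε) * τ) q h) fun A => if e ∉ A then
      expect (linkStep M x ((1 - ε) * τ) q A) fun A' => if e ∈ A' then 1 else 0 else 0 with hd
  have hu1 : ∀ h, u h ≤ 1 := fun h => expect_ite_le_one _ fun A => e ∉ A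
  have hdu : ∀ h, d h + u (h + 1) ≤ u h := by
    intro h
    simp only [hu, hd, linkIter]
    rw [expect_bind, ← expect_add]
    refine expect_mono_of_mem_support fun A hA => ?_
    by_cases heA : e ∈ A
    · simp only [heA, not_true_eq_false, if_false, zero_add]
      refine expect_le_of_le fun A' hA' => ?_
      have hsub := subset_of_mem_support_linkStep M x hτ' hq
        (subset_of_mem_support_linkIter M x _ _ h hA) hA'
      simp [hsub heA]
    · simp only [heA, not_false_eq_true, if_true]
      exact (expect_ite_add_expect_ite_not _ fun A' => e ∈ A').le
  have hstep : ∀ h, (expect (linkIter M x ((1 - ε) * τ) q h) fun A => if e ∉ A then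
      expect (activeDist x) fun S => if e ∈ M.closure (A ∪ S) then 1 else 0 else 0) ≤
      ENNReal.ofReal τ * u h + d h + δ := by
    intro h
    simp only [hu, hd]
    rw [← expect_const_mul, ← expect_add, ← expect_const (linkIter M x ((1 - ε) * τ) q h) δ,
      ← expect_add]
    refine expect_mono _ fun A => ?_
    by_cases heA : e ∈ A
    · simp [heA]
    · simp only [heA, not_false_eq_true, if_true, mul_one]
      rcases le_total (expect (activeDist x) fun S => if e ∈ M.closure (A ∪ S) then 1 else 0)
        (ENNReal.ofReal τ) with hf | hf
      · exact hf.trans (le_add_right (le_add_right le_rfl))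
      · refine (expect_ite_le_one _ _).trans ?_
        rw [add_assoc]
        refine le_add_left ?_
        refine (expect_ite_add_expect_ite_not (linkStep M x ((1 - ε) * τ) q A)
          fun A' => e ∈ A').ge.trans ?_
        gcongr
        exact expect_linkStep_notMem_le M x hτ hε0 hq0 A he hf
  have hdecr := expect_stopDist_decrement_le (ε := ε.toNNReal) (by simpa using hε1)
    (one_le_maxIter ρ ε) hu1 hdu
  rw [singleOcrsLink, expect_bind, expect_bind]
  change _ ≤ ENNReal.ofReal (τ + ε) * expect (stopDist ε.toNNReal (maxIter ρ ε) _) u + _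
  refine (expect_mono _ hstep).trans ?_
  rw [expect_add, expect_add, expect_const_mul, expect_const, ENNReal.ofReal_add hτ hε0]
  calc _ ≤ _ := add_le_add_left (add_le_add_right hdecr _) δ
    _ = _ := by
      rw [show (ε.toNNReal : ℝ≥0∞) = ENNReal.ofReal ε from rfl]
      ring

end LinkFreeness

section ErrorBounds

variable {ρ : ℕ} {ε τ : ℝ}

theorem stopWeight_one_le (hρ : 3 ≤ ρ) (hε0 : 0 < ε) :
    (stopWeight ε.toNNReal (maxIter ρ ε) 1 : ℝ) ≤ ε ^ 3 / Real.log ρ := by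
  have hlog := one_le_log_of_three_le hρ
  rw [stopWeight]
  push_cast
  rw [Real.coe_toNNReal ε hε0.le, ← one_div_div (Real.log ρ) (ε ^ 3)]
  refine one_div_le_one_div_of_le (by positivity) ?_
  set z := Real.logb (1 + ε) (Real.log ρ / ε ^ 3) with hz
  have h1 : z ≤ ((maxIter ρ ε - 1 : ℕ) : ℝ) := by
    rw [Nat.cast_sub (one_le_maxIter ρ ε)]
    have h2 : 1 + z ≤ (maxIter ρ ε : ℝ) :=
      (Nat.le_ceil _).trans (Nat.cast_le.2 (le_max_right _ _))
    push_cast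
    linarith
  rw [← Real.rpow_natCast (1 + ε), ← Real.logb_le_iff_le_rpow (by linarith) (by positivity)]
  exact h1

theorem exp_numSamples_le (hρ : 3 ≤ ρ) (hε0 : 0 < ε) (hε : ε ≤ 1 / 20) (hτ0 : 0 < τ) :
    Real.exp (-(ε ^ 2 / 2 * τ * numSamples ρ ((1 - ε) * τ) ε)) ≤ ε ^ 3 / Real.log ρ := by
  have hlog := one_le_log_of_three_le hρ
  have h1 := six_log_le_numSamples_mul (ρ := ρ) (τ := (1 - ε) * τ) hε0
    (mul_pos (by linarith) hτ0)
  set q : ℝ := (numSamples ρ ((1 - ε) * τ) ε : ℝ) with hq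
  have hq0 : 0 ≤ q := Nat.cast_nonneg _
  have h2 : 3 * Real.log (Real.log ρ / ε) ≤ ε ^ 2 / 2 * τ * q := by
    have : (0 : ℝ) ≤ q * (ε * τ * ε ^ 2) := by positivity
    linarith
  calc Real.exp (-(ε ^ 2 / 2 * τ * q)) ≤ Real.exp (-(3 * Real.log (Real.log ρ / ε))) :=
        Real.exp_le_exp.2 (neg_le_neg h2)
    _ = ε ^ 3 / Real.log ρ ^ 3 := by
        rw [Real.exp_neg, show (3 : ℝ) * Real.log (Real.log ρ / ε) =
          ((3 : ℕ) : ℝ) * Real.log (Real.log ρ / ε) by norm_num, Real.exp_nat_mul,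
          Real.exp_log (by positivity), div_pow, inv_div]
    _ ≤ _ := by
        gcongr
        exact le_self_pow₀ hlog (by norm_num)

/-- The number of links is so small that the errors of all links add up to at most `2 * ε`. -/
theorem ceil_mul_error_le (hρ : 3 ≤ ρ) (hε0 : 0 < ε) (hε : ε ≤ 1 / 20) :
    (⌈1 / ε * Real.log (ρ / ε)⌉₊ : ℝ) * (2 * (ε ^ 3 / Real.log ρ)) ≤ 2 * ε := by
  have hlog := one_le_log_of_three_le hρ
  have hρ0 : (3 : ℝ) ≤ ρ := by exact_mod_cast hρ
  have hle : Real.log (ρ / ε) = Real.log ρ + Real.log (1 / ε) := by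
    rw [Real.log_div (by linarith) hε0.ne', one_div, Real.log_inv]
    ring
  have h2 : Real.log (1 / ε) ≤ 1 / ε / 2 := by
    have h3 : Real.log (1 / ε / 2) = Real.log (1 / ε) - Real.log 2 :=
      Real.log_div (by positivity) (by norm_num)
    have h4 := Real.log_le_sub_one_of_pos (show 0 < 1 / ε / 2 by positivity)
    linarith [Real.log_two_lt_d9]
  have h20 : (20 : ℝ) ≤ 1 / ε := by
    rw [le_div_iff₀ hε0]
    linarith
  have hpos : 0 ≤ 1 / ε * Real.log (ρ / ε) := by
    rw [hle]
    have : 0 ≤ Real.log (1 / ε) := Real.log_nonneg (by linarith)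
    positivity
  have h5 := (Nat.ceil_lt_add_one hpos).le
  have hζ : (⌈1 / ε * Real.log (ρ / ε)⌉₊ : ℝ) ≤ Real.log ρ * (1 / ε ^ 2) := by
    refine h5.trans ?_
    rw [hle]
    have h6 : 1 / ε ^ 2 = 1 / ε * (1 / ε) := by field_simp
    rw [h6]
    set w := 1 / ε
    nlinarith [mul_le_mul_of_nonneg_right hlog (show 0 ≤ w * w by positivity)]
  calc _ ≤ Real.log ρ * (1 / ε ^ 2) * (2 * (ε ^ 3 / Real.log ρ)) := by gcongr
    _ = 2 * ε := by field_simp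

theorem pow_ceil_mul_le (hρ : 3 ≤ ρ) (hε0 : 0 < ε) (hε : ε ≤ 1 / 20) :
    (1 - ε) ^ ⌈1 / ε * Real.log (ρ / ε)⌉₊ * ρ ≤ ε := by
  have hρ0 : (0 : ℝ) < ρ := by exact_mod_cast (by omega : 0 < ρ)
  set ζ := ⌈1 / ε * Real.log (ρ / ε)⌉₊
  have h1 : Real.log (ρ / ε) ≤ ε * ζ := by
    calc Real.log (ρ / ε) = ε * (1 / ε * Real.log (ρ / ε)) := by field_simp
      _ ≤ ε * ζ := mul_le_mul_of_nonneg_left (Nat.le_ceil _) hε0.le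
  have h2 : (1 - ε) ^ ζ ≤ ε / ρ := by
    calc (1 - ε) ^ ζ ≤ Real.exp (-ε) ^ ζ :=
          pow_le_pow_left₀ (by linarith) (Real.one_sub_le_exp_neg ε) ζ
      _ = Real.exp (-(ε * ζ)) := by rw [← Real.exp_nat_mul]; ring_nf
      _ ≤ Real.exp (-Real.log (ρ / ε)) := Real.exp_le_exp.2 (neg_le_neg h1)
      _ = ε / ρ := by rw [Real.exp_neg, Real.exp_log (by positivity), inv_div]
  calc _ ≤ ε / ρ * ρ := by gcongr
    _ = ε := by field_simp

end ErrorBounds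

/-! ### Chains -/

section Chain

variable {α : Type*} [Fintype α]

theorem exists_cons_of_mem_support_ocrsLinks (M : Matroid α) (x : α → unitInterval) (ρ : ℕ)
    (τ ε : ℝ) (n : ℕ) {C : Set α} {chain : List (Set α)}
    (h : chain ∈ (ocrsLinks M x ρ τ ε n C).support) : ∃ C' rest, chain = C :: C' :: rest := by
  induction n generalizing C chain with
  | zero =>
    simp only [ocrsLinks, PMF.support_pure, Set.mem_singleton_iff] at h
    exact ⟨∅, [], h⟩
  | succ n ih =>
    simp only [ocrsLinks, PMF.mem_support_bind_iff, PMF.mem_support_map_iff] at h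
    obtain ⟨C', -, rest, hrest, rfl⟩ := h
    obtain ⟨C'', rest', rfl⟩ := ih hrest
    exact ⟨C', C'' :: rest', rfl⟩

theorem isSpanningChain_of_mem_support_ocrsLinks (M : Matroid α) (x : α → unitInterval) (ρ : ℕ)
    (τ ε : ℝ) (n : ℕ) {C : Set α} {chain : List (Set α)}
    (h : chain ∈ (ocrsLinks M x ρ τ ε n C).support) : IsSpanningChain C chain := by
  induction n generalizing C chain with
  | zero =>
    simp only [ocrsLinks, PMF.support_pure, Set.mem_singleton_iff] at h
    subst h
    exact ⟨rfl, rfl, by simp⟩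
  | succ n ih =>
    simp only [ocrsLinks, PMF.mem_support_bind_iff, PMF.mem_support_map_iff] at h
    obtain ⟨C', hC', rest, hrest, rfl⟩ := h
    have hsub : C' ⊆ C := subset_of_mem_support_singleOcrsLink _ _ hC'
    obtain ⟨C'', rest', rfl⟩ := exists_cons_of_mem_support_ocrsLinks M x ρ τ ε n hrest
    obtain ⟨-, hlast, hchain⟩ := ih hrest
    exact ⟨rfl, by simpa using hlast, List.isChain_cons_cons.2 ⟨hsub, hchain⟩⟩

open Classical in
/-- The elements outside of `C`, and the element `e` itself, do not matter for the bound on the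
probability of spanning `e` together with `C'`. -/
theorem expect_mem_closure_le (M : Matroid α) (x : α → unitInterval) {C C' : Set α}
    (hC : C ⊆ M.E) (hC' : C' ⊆ C) {e : α} (he : e ∈ C) :
    (expect (activeDist x) fun R => if e ∈ M.closure (((R \ {e}) ∩ C) ∪ C') then 1 else 0) ≤
      expect (activeDist (restrictVec x C)) fun S =>
        if e ∈ (M.restrict C).closure (C' ∪ S) then 1 else 0 := by
  rw [← activeDist_map_inter, expect_map]
  refine expect_mono _ fun R => ?_
  have himp : e ∈ M.closure (((R \ {e}) ∩ C) ∪ C') →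
      e ∈ (M.restrict C).closure (C' ∪ (R ∩ C)) := by
    intro h
    rw [M.restrict_closure_eq (Set.union_subset hC' Set.inter_subset_right) hC]
    refine ⟨M.closure_subset_closure ?_ h, he⟩
    rw [Set.union_comm]
    exact Set.union_subset_union_right _ (Set.inter_subset_inter_left _ Set.sdiff_subset)
  split_ifs with h1 h2
  · exact le_rfl
  · exact absurd (himp h1) h2
  · exact zero_le
  · exact le_rfl

open Classical in
theorem freeness_add_expect (M : Matroid α) (x : α → unitInterval) {e : α} {C C' : Set α}
    (rest : List (Set α)) (he : e ∈ C) (he' : e ∉ C') :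
    freeness M x e (C :: C' :: rest) + (expect (activeDist x) fun R =>
      if e ∈ M.closure (((R \ {e}) ∩ C) ∪ C') then 1 else 0) = 1 := by
  rw [freeness, if_pos ⟨he, he'⟩, add_comm,
    toOuterMeasure_eq_expect _ fun R : Set α => e ∉ M.closure (((R \ {e}) ∩ C) ∪ C')]
  exact expect_ite_add_expect_ite_not _ _

theorem freeness_cons_of_mem (M : Matroid α) (x : α → unitInterval) {e : α} {C C' : Set α}
    (rest : List (Set α)) (he' : e ∈ C') :
    freeness M x e (C :: C' :: rest) = freeness M x e (C' :: rest) := by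
  rw [freeness, if_neg fun h => h.2 he']

theorem freeness_le_one (M : Matroid α) (x : α → unitInterval) (e : α) (chain : List (Set α)) :
    freeness M x e chain ≤ 1 := by
  classical
  fun_induction freeness M x e chain with
  | case1 C C' rest h =>
    rw [toOuterMeasure_eq_expect _ fun R : Set α => e ∉ M.closure (((R \ {e}) ∩ C) ∪ C')]
    exact expect_ite_le_one _ _
  | case2 C C' rest h ih => exact ih
  | case3 => exact zero_le

open Classical in
/-- The loss in the expected freeness of `e`: a constant term for the links that release `e`, an
error `κ` for every link, and the event that `e` remains in the last link before `∅`, which is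
unlikely since the expected rank of the links decreases geometrically. -/
theorem one_le_expect_freeness_add (M : Matroid α) [M.Loopless] (x : α → unitInterval) (ρ : ℕ)
    (τ ε : ℝ) {μ κ γ : ℝ≥0∞} {e : α}
    (hlink : ∀ C ⊆ M.E, e ∈ C →
      (expect (singleOcrsLink (M.restrict C) (restrictVec x C) ρ ((1 - ε) * τ) ε) fun A =>
        if e ∉ A then expect (activeDist (restrictVec x C)) fun S =>
          if e ∈ (M.restrict C).closure (A ∪ S) then 1 else 0 else 0) ≤
      μ * (expect (singleOcrsLink (M.restrict C) (restrictVec x C) ρ ((1 - ε) * τ) ε) fun A =>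
        if e ∉ A then 1 else 0) + κ)
    (hrank : ∀ C ⊆ M.E,
      (expect (singleOcrsLink (M.restrict C) (restrictVec x C) ρ ((1 - ε) * τ) ε) fun A =>
        (rk M A : ℝ≥0∞)) ≤ γ * rk M C)
    (n : ℕ) {C : Set α} (hC : C ⊆ M.E) (he : e ∈ C) :
    1 ≤ expect (ocrsLinks M x ρ τ ε n C) (freeness M x e) + μ + n * κ + γ ^ n * rk M C := by
  induction n generalizing C with
  | zero =>
    refine le_add_left ?_
    rw [pow_zero, one_mul]
    exact_mod_cast one_le_rk_of_mem M (hC he) he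
  | succ n ih =>
    rw [ocrsLinks, expect_bind]
    simp only [expect_map]
    set p := singleOcrsLink (M.restrict C) (restrictVec x C) ρ ((1 - ε) * τ) ε with hp
    set F : Set α → ℝ≥0∞ := fun C' =>
      expect (ocrsLinks M x ρ τ ε n C') fun rest => freeness M x e (C :: rest) with hF
    set f : Set α → ℝ≥0∞ := fun A => expect (activeDist (restrictVec x C)) fun S =>
      if e ∈ (M.restrict C).closure (A ∪ S) then 1 else 0 with hf
    have hpt : ∀ C' ∈ p.support, 1 ≤ F C' + (if e ∉ C' then f C' else 0) +
        (if e ∈ C' then 1 else 0) * μ + n * κ + γ ^ n * rk M C' := by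
      intro C' hC'
      have hsub : C' ⊆ C := subset_of_mem_support_singleOcrsLink _ _ hC'
      by_cases heC' : e ∈ C'
      · have h1 : F C' = expect (ocrsLinks M x ρ τ ε n C') (freeness M x e) := by
          refine le_antisymm ?_ ?_ <;>
          · refine expect_mono_of_mem_support fun chain hchain => le_of_eq ?_
            obtain ⟨C'', rest, rfl⟩ := exists_cons_of_mem_support_ocrsLinks M x ρ τ ε n hchain
            simp only [freeness_cons_of_mem M x (C := C) (C'' :: rest) heC']
        simpa [heC', h1] using ih (hsub.trans hC) heC'
      · refine le_trans ?_ (le_add_right (le_add_right (le_add_right le_rfl)))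
        rw [if_pos heC', ← expect_const (ocrsLinks M x ρ τ ε n C') (f C'), hF]
        simp only
        rw [← expect_add]
        refine (expect_const (ocrsLinks M x ρ τ ε n C') 1).ge.trans
          (expect_mono_of_mem_support fun chain hchain => ?_)
        obtain ⟨C'', rest, rfl⟩ := exists_cons_of_mem_support_ocrsLinks M x ρ τ ε n hchain
        refine (freeness_add_expect M x (C'' :: rest) he heC').ge.trans ?_
        gcongr
        exact expect_mem_closure_le M x hC hsub he
    have h := (expect_const p 1).ge.trans (expect_mono_of_mem_support hpt)
    simp only [expect_add, expect_mul_const, expect_const_mul, expect_const] at h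
    refine h.trans ?_
    calc _ ≤ expect p F + (μ * (expect p fun A => if e ∉ A then 1 else 0) + κ) +
          (expect p fun A => if e ∈ A then 1 else 0) * μ + n * κ + γ ^ n * (γ * rk M C) := by
          gcongr
          · exact hlink C hC he
          · exact hrank C hC
      _ = expect p F + ((expect p fun A => if e ∈ A then 1 else 0) +
          (expect p fun A => if e ∉ A then 1 else 0)) * μ + (n + 1 : ℕ) * κ +
          γ ^ (n + 1) * rk M C := by
          push_cast
          ring
      _ = _ := by
          rw [expect_ite_add_expect_ite_not p fun A => e ∈ A, one_mul]


theorem isBalancedSpanningChainDist_ocrsChain (M : Matroid α) [M.Loopless]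
    {ε : ℝ} (hε0 : 0 < ε) (hε : ε ≤ 1 / 20) {l : ℝ} (hl0 : 0 < l) (hl : l ≤ 1 - 4 * ε)
    (x : α → unitInterval) (hx : (fun e => (x e : ℝ)) ∈ l • matroidPolytope M) :
    IsBalancedSpanningChainDist M x (1 - l - 8 * ε) (ocrsChain M x (l + 4 * ε) ε) := by
  classical
  refine ⟨fun chain h => isSpanningChain_of_mem_support_ocrsLinks M x _ _ _ _ h, fun e he => ?_⟩
  set ρ : ℕ := max M.eRank.toNat 3 with hρdef
  have hρ : 3 ≤ ρ := le_max_right _ _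
  set ζ : ℕ := ⌈1 / ε * Real.log (ρ / ε)⌉₊ with hζ
  set τ := l + 4 * ε with hτ
  have hτ'0 : 0 < (1 - ε) * τ := by
    have : 0 < 1 - ε := by linarith
    positivity
  have hτ'1 : (1 - ε) * τ ≤ 1 - ε := by nlinarith
  set δ : ℝ := 2 * (ε ^ 3 / Real.log ρ) with hδ
  have hδ0 : 0 ≤ δ := by
    have := one_le_log_of_three_le hρ
    positivity
  have hlink := fun (C : Set α) (hC : C ⊆ M.E) (heC : e ∈ C) =>
    (expect_singleOcrsLink_spanned_le (M.restrict C) (restrictVec x C)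
      (ρ := ρ) (τ := τ) (by linarith) hε0.le (by linarith)
      (floor_mul_numSamples_lt hρ hε0 hε hτ'0 hτ'1) (e := e) heC).trans
      (add_le_add_right (show _ ≤ ENNReal.ofReal δ by
        rw [hδ, two_mul, ENNReal.ofReal_add (by positivity) (by positivity)]
        refine add_le_add ?_ (ENNReal.ofReal_le_ofReal
          (exp_numSamples_le hρ hε0 hε (by linarith)))
        rw [← ENNReal.ofReal_coe_nnreal]
        exact ENNReal.ofReal_le_ofReal (stopWeight_one_le hρ hε0)) _)
  have hrank : ∀ C ⊆ M.E,
      (expect (singleOcrsLink (M.restrict C)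
        (restrictVec x C) ρ ((1 - ε) * τ) ε) fun A =>
        (rk M A : ℝ≥0∞)) ≤ ENNReal.ofReal (1 - ε) * rk M C := by
    intro C hC
    have hE : (M.restrict C).E = C := rfl
    have h := expect_rk_singleOcrsLink_le (M.restrict C)
      (restrictVec x C) hρ hε0 hε hl0 hl (by
        rw [hE, rk_restrict M subset_rfl]
        refine le_trans (expect_mono_of_mem_support fun S hS => ?_)
          (expect_rk_le M hl0.le x hx C)
        rw [← activeDist_map_inter, PMF.mem_support_map_iff] at hS
        obtain ⟨R, -, rfl⟩ := hS
        rw [rk_restrict M Set.inter_subset_right])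
    rw [hE, rk_restrict M subset_rfl] at h
    refine le_trans (expect_mono_of_mem_support fun A hA => ?_) h
    have hAC : A ⊆ C := subset_of_mem_support_singleOcrsLink (M.restrict C) _ hA
    rw [rk_restrict M hAC]
  have main := one_le_expect_freeness_add M x ρ τ ε hlink hrank ζ subset_rfl he
  have hρrk : (rk M M.E : ℝ) ≤ ρ := by
    rw [rk, M.eRk_ground]
    exact_mod_cast le_max_left _ _
  have hlast : ENNReal.ofReal (1 - ε) ^ ζ * rk M M.E ≤ ENNReal.ofReal ε := by
    rw [← ENNReal.ofReal_pow (by linarith), ← ENNReal.ofReal_natCast,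
      ← ENNReal.ofReal_mul (pow_nonneg (by linarith) _)]
    refine ENNReal.ofReal_le_ofReal (le_trans ?_ (pow_ceil_mul_le hρ hε0 hε))
    exact mul_le_mul_of_nonneg_left hρrk (pow_nonneg (by linarith) _)
  have herr : (ζ : ℝ≥0∞) * ENNReal.ofReal δ ≤ ENNReal.ofReal (2 * ε) := by
    rw [← ENNReal.ofReal_natCast, ← ENNReal.ofReal_mul (Nat.cast_nonneg _)]
    exact ENNReal.ofReal_le_ofReal (ceil_mul_error_le hρ hε0 hε)
  have hsum : 1 ≤ expect (ocrsChain M x τ ε)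
      (freeness M x e) + ENNReal.ofReal (l + 8 * ε) := by
    have hsplit : ENNReal.ofReal (l + 8 * ε) =
        ENNReal.ofReal (τ + ε) + ENNReal.ofReal (2 * ε) + ENNReal.ofReal ε := by
      rw [← ENNReal.ofReal_add (by linarith) (by linarith),
        ← ENNReal.ofReal_add (by linarith) hε0.le]
      congr 1
      rw [hτ]
      ring
    rw [hsplit, ← add_assoc, ← add_assoc]
    exact main.trans (add_le_add (add_le_add le_rfl herr) hlast)
  change _ ≤ (expect (ocrsChain M x τ ε) (freeness M x e)).toReal
  have hfree : expect (ocrsChain M x τ ε) (freeness M x e) ≠ ∞ :=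
    ne_top_of_le_ne_top ENNReal.one_ne_top (expect_le_of_le fun _ _ => freeness_le_one M x e _)
  have h := ENNReal.toReal_mono (by finiteness) hsum
  rw [ENNReal.toReal_add hfree ENNReal.ofReal_ne_top, ENNReal.toReal_ofReal (by linarith),
    ENNReal.toReal_one] at h
  linarith

end Chain

end MatroidOCRS

end

theorem theorem4 {α : Type*} [Fintype α] (M : Matroid α) [M.Loopless]
    (ε : ℝ) (hε0 : 0 < ε) (hε : ε ≤ 1 / 20)
    (l : ℝ) (hl0 : 0 < l) (hl : l ≤ 1 - 4 * ε)
    (x : α → unitInterval)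
    (hx : (fun e => (x e : ℝ)) ∈ l • MatroidOCRS.matroidPolytope M) :
    MatroidOCRS.IsBalancedSpanningChainDist M x (1 - l - 8 * ε)
      (MatroidOCRS.ocrsChain M x (l + 4 * ε) ε) := by
  exact MatroidOCRS.isBalancedSpanningChainDist_ocrsChain M hε0 hε hl0 hl x hx
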